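/- Let $n\ge 2$ and let $\mathcal V$ be an infinite set of variables containing pairwise distinct variables $x_1,x_2,\dots$. Let $\mathbb F_\otimes(\mathcal V)$ be the set of terms over one $n$-ary operation symbol $\otimes$; for a substitution $\varphi:\mathcal V\to\mathbb F_\otimes(\mathcal V)$ write $s^\varphi$ for the image of the term $s$. For $i\le j$ write $x_i^j$ for the list $x_i,\dots,x_j$ (empty if $i>j$). Let $SC_n$ be the theory of symmetric $n$-catalan algebras, with the equations $$\otimes(x_1^i,\otimes(x_{i+1}^{i+n}),x_{i+n+1}^{2n-1})=\otimes(x_1^{i-1},\otimes(x_i^{i+n-1}),x_{i+n}^{2n-1}),\qquad \otimes(x_1^{i-1},x_i,x_{i+1},x_{i+2}^n)=\otimes(x_1^{i-1},x_{i+1},x_i,x_{i+2}^n)\qquad(1\le i<n).$$ For terms $s,t$ with the same variables let $\rho_{s,t}$ be the partial map on $\mathbb F_\otimes(\mathcal V)$ with graph $\{(s^\varphi,t^\varphi)\}$, $\varphi$ ranging over all substitutions, and for an address $\alpha$ (a word over $\{1,\dots,n\}$) let $\rho_{s,t}^\alpha$ be the partial map that applies $\rho_{s,t}$ to the subterm at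 $\alpha$. Let $\mathrm{Struct}(SC_n)$ be the monoid of partial maps generated under composition ($f\cdot g$ is $f$ followed by $g$) by all $\rho_{s,t}^\alpha$ with $(s,t)$ or $(t,s)$ an equation of $SC_n$, and let the structure group $\mathrm{Struct}_G(SC_n)$ be its universal group. A seed of a partial map $\rho$ is a pair of terms $(s,t)$ such that the graph of $\rho$ is $\{(s^\varphi,t^\varphi)\}$, $\varphi$ ranging over all substitutions. Let $G_{n,1}$ be the Higman–Thompson group. Its elements are the classes $[(T_1,T_2,\sigma)]$ of triples of two finite rooted $n$-ary trees and a bijection $\sigma$ from the leaves of $T_1$ to the leaves of $T_2$, two triples being equivalent if they have a common expansion. (A simple expansion attaches $n$ children to a leaf $l$ of $T_1$ and to the leaf $\sigma(l)$ of $T_2$ and matches the children in order; an expansion is the result of finitely many simple expansions.) The product is $[(T_1,T,\sigma)][(T,T_2,\sigma')]=[(T_1,T_2,\sigma\cdot\sigma')]$, where $\sigma\cdot\sigma'$ is $\sigma$ followed by $\sigma'$. Then $\mathrm{Struct}_G(SC_n)\cong G_{n,1}$. More precisely, there is a group isomorphism $\Theta:\mathrm{Struct}_G(SC_n)\to G_{n,1}$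 such that, for every $\rho\in\mathrm{Struct}(SC_n)$: $\rho$ has a seed, and for every seed $(s,t)$ of $\rho$, no variable occurs twice in $s$ or twice in $t$, the same variables occur in $s$ and in $t$, and the class of $\rho$ is sent by $\Theta$ to $[(T(s),T(t),\pi)]$, where $T(s),T(t)$ are the trees of the terms $s,t$ and $\pi$ sends the leaf of $T(s)$ labelled by a variable $x$ to the leaf of $T(t)$ labelled by $x$. -/

import Mathlib

/-! ### Terms over a single `n`-ary operation symbol -/

/-- The absolutely free algebra `F_⊗(V)`: terms in the variables `V` over one `n`-ary operation
symbol `⊗`, here written `op`. -/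
inductive CatTerm (n : ℕ) (V : Type*) where
  | var : V → CatTerm n V
  | op : (Fin n → CatTerm n V) → CatTerm n V

namespace CatTerm

variable {n : ℕ} {V : Type*}

/-- The image `s^φ` of a term under a substitution `φ`. -/
def subst (φ : V → CatTerm n V) : CatTerm n V → CatTerm n V
  | var x => φ x
  | op ts => op fun i => (ts i).subst φ

/-- The underlying list of variables `U(t)`, read from left to right. -/
def underlyingList : CatTerm n V → List V
  | var x => [x]
  | op ts => (List.ofFn fun i => (ts i).underlyingList).flatten

/-- The support: the set of variables that occur in the term. -/
def support (t : CatTerm n V) : Set V := {x | x ∈ t.underlyingList}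

/-- A term is linear if no variable occurs in it more than once. -/
def Linear (t : CatTerm n V) : Prop := t.underlyingList.Nodup

/-- The subterm `sub(t, α)` at the address `α`, if it exists. As there is just one operation symbol,
an address is a word in the argument positions. -/
def sub : CatTerm n V → List (Fin n) → Option (CatTerm n V)
  | t, [] => some t
  | var _, _ :: _ => none
  | op ts, i :: α => (ts i).sub α

theorem subst_congr (φ ψ : V → CatTerm n V) (t : CatTerm n V)
    (h : ∀ x ∈ t.support, φ x = ψ x) : t.subst φ = t.subst ψ := by
  induction t with
  | var x => exact h x (by simp [support, underlyingList])
  | op ts ih =>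
    simp only [subst, op.injEq]
    funext i
    refine ih i fun x hx => h x ?_
    simp only [support, underlyingList, Set.mem_ofPred_eq, List.mem_flatten, List.mem_ofFn] at hx ⊢
    exact ⟨_, ⟨i, rfl⟩, hx⟩

theorem eq_of_subst_eq (φ ψ : V → CatTerm n V) (t : CatTerm n V)
    (h : t.subst φ = t.subst ψ) : ∀ x ∈ t.support, φ x = ψ x := by
  induction t with
  | var x =>
    intro y hy
    simp only [support, underlyingList, Set.mem_ofPred_eq, List.mem_singleton] at hy
    subst hy
    exact h
  | op ts ih =>
    intro x hx
    simp only [support, underlyingList, Set.mem_ofPred_eq, List.mem_flatten, List.mem_ofFn] at hx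
    obtain ⟨_, ⟨i, rfl⟩, hx⟩ := hx
    simp only [subst, op.injEq] at h
    exact ih i (congrFun h i) x hx

end CatTerm

/-! ### The structure monoid and the structure group -/

/-- Partial maps from `X` to itself. -/
def PartialEndo (X : Type*) := X →. X

/-- The monoid of partial maps; the product `f * g` is `f` followed by `g`. -/
instance (X : Type*) : Monoid (PartialEndo X) where
  mul f g := PFun.comp g f
  one := PFun.id X
  mul_assoc f g h := (PFun.comp_assoc h g f).symm
  one_mul f := PFun.comp_id f
  mul_one f := PFun.id_comp f

section Struct

variable {n : ℕ} {V : Type*}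

/-- The partial map `ρ_{s,t}` sending `s^φ` to `t^φ` for each substitution `φ`. It is meant for
balanced pairs, for which its graph is `{(s^φ, t^φ)}`, see `mem_basicOperator`. -/
noncomputable def basicOperator (s t : CatTerm n V) : PartialEndo (CatTerm n V) := fun u =>
  ⟨∃ φ, s.subst φ = u, fun h => t.subst h.choose⟩

theorem mem_basicOperator {s t : CatTerm n V} (hst : s.support = t.support) (u v : CatTerm n V) :
    v ∈ basicOperator s t u ↔ ∃ φ : V → CatTerm n V, u = s.subst φ ∧ v = t.subst φ := by
  constructor
  · rintro ⟨h, rfl⟩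
    exact ⟨h.choose, h.choose_spec.symm, rfl⟩
  · rintro ⟨φ, rfl, rfl⟩
    refine ⟨⟨φ, rfl⟩, ?_⟩
    have h : ∃ ψ : V → CatTerm n V, s.subst ψ = s.subst φ := ⟨φ, rfl⟩
    refine CatTerm.subst_congr _ _ t fun x hx => ?_
    exact CatTerm.eq_of_subst_eq _ _ s h.choose_spec x (hst ▸ hx)

/-- The `α`-translated copy of a partial map `f`: it applies `f` to the subterm at the address `α`
and leaves the rest of the term unchanged. It is undefined if there is no subterm at `α` or if that
subterm is outside the domain of `f`. -/
def translatedCopy (f : PartialEndo (CatTerm n V)) :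
    List (Fin n) → CatTerm n V → Part (CatTerm n V)
  | [], u => f u
  | _ :: _, .var _ => Part.none
  | i :: α, .op ts => (translatedCopy f α (ts i)).map fun v => .op (Function.update ts i v)

/-- The structure monoid of the theory with the set `E` of equations. -/
def structureMonoid (E : Set (CatTerm n V × CatTerm n V)) :
    Submonoid (PartialEndo (CatTerm n V)) :=
  Submonoid.closure {f | ∃ (s t : CatTerm n V) (α : List (Fin n)),
    ((s, t) ∈ E ∨ (t, s) ∈ E) ∧ f = translatedCopy (basicOperator s t) α}

/-- A seed for `ρ`: a pair of terms `(s, t)` such that the graph of `ρ` is `{(s^φ, t^φ)}`. -/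
def IsSeed (ρ : PartialEndo (CatTerm n V)) (s t : CatTerm n V) : Prop :=
  ∀ u v, v ∈ ρ u ↔ ∃ φ : V → CatTerm n V, u = s.subst φ ∧ v = t.subst φ

end Struct

/-- The universal group of a monoid `M`: the group generated by the elements of `M` subject to all
the relations `a · b = ab` that hold in `M`. (Idempotents of `M` become trivial in it.) -/
abbrev UniversalGroup (M : Type*) [Monoid M] :=
  PresentedGroup {r : FreeGroup M |
    ∃ a b : M, r = FreeGroup.of a * FreeGroup.of b * (FreeGroup.of (a * b))⁻¹}

/-- The canonical map from a monoid to its universal group. -/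
def toUniversalGroup {M : Type*} [Monoid M] (a : M) : UniversalGroup M := PresentedGroup.of a

/-- The structure group of a theory: the universal group of its structure monoid. -/
abbrev StructureGroup {n : ℕ} {V : Type*} (E : Set (CatTerm n V × CatTerm n V)) :=
  UniversalGroup (structureMonoid E)

/-! ### Symmetric `n`-catalan algebras -/

section Theory

variable (n : ℕ) {V : Type*} (x : ℕ → V)

/-- The term `⊗(x_0, …, x_{j-1}, ⊗(x_j, …, x_{j+n-1}), x_{j+n}, …, x_{2n-2})`. -/
def catalanTerm (j : ℕ) : CatTerm n V :=
  .op fun k => if (k : ℕ) < j then .var (x k)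
    else if (k : ℕ) = j then .op fun m => .var (x (j + m))
    else .var (x ((k : ℕ) + n - 1))

/-- The equations of `n`-catalan algebras: the inner operation at position `i` may be moved to
position `i - 1`, for `0 < i < n` (positions are counted from `0`). -/
def catalanEquations : Set (CatTerm n V × CatTerm n V) :=
  {e | ∃ i : ℕ, 0 < i ∧ i < n ∧ e = (catalanTerm n x i, catalanTerm n x (i - 1))}

/-- The equations of symmetric `n`-catalan algebras: those of `n`-catalan algebras together with
the transpositions of two adjacent arguments `i`, `i + 1` of `⊗(x_0, …, x_{n-1})`. -/
def symmetricCatalanEquations : Set (CatTerm n V × CatTerm n V) :=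
  catalanEquations n x ∪
  {e | ∃ i : ℕ, i + 1 < n ∧
    e = (.op fun k => .var (x k), .op fun k => .var (x (Equiv.swap i (i + 1) (k : ℕ))))}

end Theory

/-! ### `n`-ary trees and tree diagrams -/

/-- Finite rooted (ordered) `n`-ary trees. -/
inductive NTree (n : ℕ) where
  | leaf : NTree n
  | node : (Fin n → NTree n) → NTree n

namespace NTree

variable {n : ℕ}

/-- The leaves of a tree, as addresses, i.e. as words over `Fin n`. -/
def leaves : NTree n → Set (List (Fin n))
  | leaf => {[]}
  | node ts => {w | ∃ i, ∃ v ∈ (ts i).leaves, w = i :: v}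

/-- The simple expansion of a tree at the leaf `w`, which is replaced by a node with `n` leaves
`w ++ [i]`. (The value is meaningless if `w` is not a leaf.) -/
def expand : NTree n → List (Fin n) → NTree n
  | leaf, [] => node fun _ => leaf
  | leaf, _ :: _ => leaf
  | node ts, [] => node ts
  | node ts, i :: w => node (Function.update ts i ((ts i).expand w))

theorem eq_of_prefix {T : NTree n} {a u : List (Fin n)} (ha : a ∈ T.leaves)
    (hb : a ++ u ∈ T.leaves) : u = [] := by
  induction T generalizing a with
  | leaf => simp_all [leaves]
  | node ts ih =>
    obtain ⟨i, v, hv, rfl⟩ := ha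
    obtain ⟨j, v', hv', h⟩ := hb
    simp only [List.cons_append, List.cons.injEq] at h
    obtain ⟨rfl, rfl⟩ := h
    exact ih _ hv hv'

theorem leaves_injective : Function.Injective (leaves (n := n)) := by
  intro T
  induction T with
  | leaf =>
    intro S h
    cases S with
    | leaf => rfl
    | node us =>
      have : ([] : List (Fin n)) ∈ (node us).leaves := h ▸ (by simp [leaves])
      simp [leaves] at this
  | node ts ih =>
    intro S h
    cases S with
    | leaf =>
      have : ([] : List (Fin n)) ∈ (node ts).leaves := h ▸ (by simp [leaves])
      simp [leaves] at this
    | node us =>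
      congr 1
      funext i
      apply ih
      ext w
      have := Set.ext_iff.1 h (i :: w)
      simpa [leaves] using this

theorem mem_leaves_expand {T : NTree n} {l : List (Fin n)} (hl : l ∈ T.leaves)
    (a : List (Fin n)) :
    a ∈ (T.expand l).leaves ↔ (a ∈ T.leaves ∧ a ≠ l) ∨ ∃ i, a = l ++ [i] := by
  induction T generalizing l a with
  | leaf =>
    obtain rfl : l = [] := hl
    simp [leaves, expand]
  | node ts ih =>
    obtain ⟨i, v, hv, rfl⟩ := hl
    cases a with
    | nil => simp [leaves, expand]
    | cons j b =>
      by_cases hij : j = i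
      · subst hij
        have := ih j hv b
        simpa [leaves, expand] using this
      · simp [leaves, expand, hij, Function.update_of_ne]

/-- `S` is an expansion of `T`: it arises by finitely many successive simple expansions. -/
def Expands : NTree n → NTree n → Prop :=
  Relation.ReflTransGen fun T S => ∃ l ∈ T.leaves, S = T.expand l

theorem expands_update (ts : Fin n → NTree n) (i : Fin n) {a b : NTree n} (h : Expands a b) :
    Expands (node (Function.update ts i a)) (node (Function.update ts i b)) := by
  refine Relation.ReflTransGen.lift (fun c => node (Function.update ts i c)) ?_ _ _ h
  rintro c d ⟨l, hl, rfl⟩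
  exact ⟨i :: l, ⟨i, l, by simpa using hl, rfl⟩, by simp [expand]⟩

theorem expands_node {ts us : Fin n → NTree n} (h : ∀ i, Expands (ts i) (us i)) :
    Expands (node ts) (node us) := by
  classical
  have key : ∀ s : Finset (Fin n), Expands (node ts) (node (s.piecewise us ts)) := by
    intro s
    induction s using Finset.induction_on with
    | empty =>
      rw [Finset.piecewise_empty]
      exact Relation.ReflTransGen.refl
    | insert i s hi ih =>
      refine ih.trans ?_
      have := expands_update (s.piecewise us ts) i (h i)
      have hi' : Function.update (s.piecewise us ts) i (ts i) = s.piecewise us ts := by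
        rw [Function.update_eq_self_iff]
        simp [hi]
      rw [hi'] at this
      rwa [Finset.piecewise_insert]
  simpa using key Finset.univ

theorem leaf_expands (T : NTree n) : Expands leaf T := by
  induction T with
  | leaf => exact Relation.ReflTransGen.refl
  | node ts ih =>
    exact Relation.ReflTransGen.head ⟨[], rfl, rfl⟩ (expands_node ih)

theorem exists_common_expansion (T S : NTree n) : ∃ R, Expands T R ∧ Expands S R := by
  induction T generalizing S with
  | leaf => exact ⟨S, leaf_expands S, Relation.ReflTransGen.refl⟩
  | node ts ih =>
    cases S with
    | leaf => exact ⟨node ts, Relation.ReflTransGen.refl, leaf_expands _⟩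
    | node us =>
      choose R h1 h2 using fun i => ih i (us i)
      exact ⟨node R, expands_node h1, expands_node h2⟩

end NTree

/-- An `n`-ary tree diagram: two `n`-ary trees with a bijection between their sets of leaves. -/
structure TreeDiagram (n : ℕ) where
  /-- the first tree -/
  dom : NTree n
  /-- the second tree -/
  cod : NTree n
  /-- the bijection between the leaves -/
  perm : dom.leaves ≃ cod.leaves

namespace TreeDiagram

variable {n : ℕ}

/-- The bijection of the diagram sends the leaf `a` to the leaf `b`. -/
def Maps (D : TreeDiagram n) (a b : List (Fin n)) : Prop :=
  ∃ h : a ∈ D.dom.leaves, (D.perm ⟨a, h⟩ : List (Fin n)) = b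

/-- `D'` is the simple expansion of `D` at the leaf `l`: both trees are expanded, at `l` and at its
image, and the bijection of `D'` agrees with that of `D` away from `l` and sends the `i`-th child
of `l` to the `i`-th child of the image of `l`. -/
def SimpleExpansionAt (D : TreeDiagram n) (l : D.dom.leaves) (D' : TreeDiagram n) : Prop :=
  D'.dom = D.dom.expand l ∧ D'.cod = D.cod.expand (D.perm l) ∧
  (∀ k : D.dom.leaves, k ≠ l → D'.Maps k (D.perm k)) ∧
  ∀ i : Fin n, D'.Maps (l ++ [i]) (D.perm l ++ [i])

/-- `D'` is an expansion of `D`: it arises by finitely many successive simple expansions. -/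
def Expands : TreeDiagram n → TreeDiagram n → Prop :=
  Relation.ReflTransGen fun D D' => ∃ l, D.SimpleExpansionAt l D'

/-- The inverse diagram. -/
def symm (D : TreeDiagram n) : TreeDiagram n := ⟨D.cod, D.dom, D.perm.symm⟩

theorem Maps.mem_dom {D : TreeDiagram n} {a b : List (Fin n)} (h : D.Maps a b) :
    a ∈ D.dom.leaves := h.1

theorem Maps.mem_cod {D : TreeDiagram n} {a b : List (Fin n)} (h : D.Maps a b) :
    b ∈ D.cod.leaves := by
  obtain ⟨h, rfl⟩ := h
  exact Subtype.property _

theorem Maps.unique {D : TreeDiagram n} {a b c : List (Fin n)} (h : D.Maps a b)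
    (h' : D.Maps a c) : b = c := by
  obtain ⟨h, rfl⟩ := h
  exact h'.2

theorem maps_symm {D : TreeDiagram n} {a b : List (Fin n)} : D.symm.Maps b a ↔ D.Maps a b := by
  constructor
  · rintro ⟨h, rfl⟩
    refine ⟨Subtype.property _, ?_⟩
    change ((D.perm (D.perm.symm ⟨b, h⟩) : D.cod.leaves) : List (Fin n)) = b
    simp
  · rintro ⟨h, rfl⟩
    refine ⟨Subtype.property _, ?_⟩
    change ((D.perm.symm (D.perm ⟨a, h⟩) : D.dom.leaves) : List (Fin n)) = a
    simp

theorem maps_perm (D : TreeDiagram n) (l : D.dom.leaves) : D.Maps l (D.perm l) := ⟨l.2, rfl⟩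

/-- A diagram is determined by its first tree and the values of its bijection. -/
theorem ext_maps {D E : TreeDiagram n} (hd : D.dom = E.dom)
    (h : ∀ a ∈ D.dom.leaves, ∃ b, D.Maps a b ∧ E.Maps a b) : D = E := by
  have hm : ∀ a b, D.Maps a b ↔ E.Maps a b := by
    intro a b
    constructor
    · intro hab
      obtain ⟨c, h1, h2⟩ := h a hab.mem_dom
      rwa [hab.unique h1]
    · intro hab
      obtain ⟨c, h1, h2⟩ := h a (hd ▸ hab.mem_dom)
      rwa [hab.unique h2]
  have hc : D.cod = E.cod := by
    apply NTree.leaves_injective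
    ext b
    constructor
    · intro hb
      have := maps_symm.1 (D.symm.maps_perm ⟨b, hb⟩)
      exact ((hm _ _).1 this).mem_cod
    · intro hb
      have := maps_symm.1 (E.symm.maps_perm ⟨b, hb⟩)
      exact ((hm _ _).2 this).mem_cod
  obtain ⟨d, c, p⟩ := D
  obtain ⟨d', c', p'⟩ := E
  obtain rfl : d = d' := hd
  obtain rfl : c = c' := hc
  congr 1
  ext l : 2
  have := (hm l _).1 (maps_perm ⟨d, c, p⟩ l)
  exact this.2.symm

theorem SimpleExpansionAt.symm {D E : TreeDiagram n} {l : D.dom.leaves}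
    (h : D.SimpleExpansionAt l E) : D.symm.SimpleExpansionAt (D.perm l) E.symm := by
  obtain ⟨h1, h2, h3, h4⟩ := h
  refine ⟨h2, ?_, ?_, ?_⟩
  · change E.dom = D.dom.expand (D.perm.symm (D.perm l))
    simpa using h1
  · intro k hk
    rw [maps_symm]
    have hk' : D.perm (D.perm.symm k) = k := D.perm.apply_symm_apply k
    have := h3 (D.perm.symm k) (fun h => hk (hk'.symm.trans (congrArg D.perm h)))
    exact (congrArg (fun m : D.cod.leaves => E.Maps (D.perm.symm k) m) hk').mp this
  · intro i
    rw [maps_symm]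
    have := h4 i
    change E.Maps (D.perm.symm (D.perm l) ++ [i]) _
    simpa using this

theorem Expands.symm {D E : TreeDiagram n} (h : D.Expands E) : D.symm.Expands E.symm := by
  refine Relation.ReflTransGen.lift TreeDiagram.symm ?_ _ _ h
  rintro D E ⟨l, h⟩
  exact ⟨_, h.symm⟩

theorem Expands.dom {D E : TreeDiagram n} (h : D.Expands E) : D.dom.Expands E.dom := by
  refine Relation.ReflTransGen.lift TreeDiagram.dom ?_ _ _ h
  rintro D E ⟨l, h⟩
  exact ⟨l, l.2, h.1⟩

theorem exists_prefix {T S : NTree n} (h : T.Expands S) :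
    ∀ c ∈ S.leaves, ∃ a ∈ T.leaves, ∃ u, c = a ++ u := by
  induction h with
  | refl => exact fun c hc => ⟨c, hc, [], by simp⟩
  | tail _ hs ih =>
    obtain ⟨l, hl, rfl⟩ := hs
    intro c hc
    rcases (NTree.mem_leaves_expand hl c).1 hc with ⟨hc, -⟩ | ⟨i, rfl⟩
    · exact ih c hc
    · obtain ⟨a, ha, u, rfl⟩ := ih l hl
      exact ⟨a, ha, u ++ [i], by simp⟩

/-- An expansion acts as the original diagram on prefixes. -/
theorem Expands.maps {D E : TreeDiagram n} (h : D.Expands E) :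
    ∀ a b u, D.Maps a b → a ++ u ∈ E.dom.leaves → E.Maps (a ++ u) (b ++ u) := by
  induction h with
  | refl =>
    intro a b u hab hau
    obtain rfl := NTree.eq_of_prefix hab.mem_dom hau
    simpa using hab
  | @tail E F hDE hs ih =>
    obtain ⟨l, h1, h2, h3, h4⟩ := hs
    intro a b u hab hau
    rw [h1] at hau
    rcases (NTree.mem_leaves_expand l.2 _).1 hau with ⟨hau, hne⟩ | ⟨i, hi⟩
    · have hE := ih a b u hab hau
      obtain ⟨_, hE2⟩ := hE
      have := h3 ⟨a ++ u, hau⟩ (fun h => hne (congrArg Subtype.val h))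
      rwa [hE2] at this
    · rcases List.eq_nil_or_concat u with rfl | ⟨v, j, rfl⟩
      · exfalso
        obtain ⟨a', ha', w, hw⟩ := exists_prefix (Expands.dom hDE) l l.2
        rw [List.append_nil] at hi
        have := hab.mem_dom
        rw [hi, hw, List.append_assoc] at this
        have := NTree.eq_of_prefix ha' this
        simp at this
      · simp only [List.concat_eq_append] at hi ⊢
        rw [← List.append_assoc] at hi
        obtain ⟨hv, hj⟩ := List.append_inj' hi rfl
        obtain rfl : j = i := by simpa using hj
        have hE := ih a b v hab (hv ▸ l.2)
        rw [hv] at hE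
        have hp := hE.unique (E.maps_perm l)
        have := h4 j
        rw [← List.append_assoc, ← List.append_assoc, hv, hp]
        exact this

theorem Expands.eq_of_dom_eq {D E F : TreeDiagram n} (hE : D.Expands E) (hF : D.Expands F)
    (h : E.dom = F.dom) : E = F := by
  refine ext_maps h fun c hc => ?_
  obtain ⟨a, ha, u, rfl⟩ := exists_prefix hE.dom c hc
  exact ⟨_, hE.maps _ _ u (D.maps_perm ⟨a, ha⟩) hc, hF.maps _ _ u (D.maps_perm ⟨a, ha⟩) (h ▸ hc)⟩

open Classical in
/-- The value of the expanded bijection. -/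
noncomputable def expandFun {T S : NTree n} (σ : T.leaves ≃ S.leaves) (l : T.leaves)
    (a : List (Fin n)) : List (Fin n) :=
  if h : a ∈ T.leaves then σ ⟨a, h⟩ else σ l ++ a.drop (l : List (Fin n)).length

theorem append_not_mem {T : NTree n} (l : T.leaves) (i : Fin n) :
    (l : List (Fin n)) ++ [i] ∉ T.leaves := fun h => by
  simpa using NTree.eq_of_prefix l.2 h

theorem expandFun_mem {T S : NTree n} (σ : T.leaves ≃ S.leaves) (l : T.leaves)
    {a : List (Fin n)} (ha : a ∈ (T.expand l).leaves) :
    expandFun σ l a ∈ (S.expand (σ l)).leaves := by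
  rw [NTree.mem_leaves_expand (σ l).2]
  rcases (NTree.mem_leaves_expand l.2 _).1 ha with ⟨ha, hne⟩ | ⟨i, rfl⟩
  · left
    rw [expandFun, dif_pos ha]
    refine ⟨Subtype.property _, fun h => hne ?_⟩
    exact congrArg Subtype.val (σ.injective (Subtype.ext h))
  · right
    rw [expandFun, dif_neg (append_not_mem l i)]
    exact ⟨i, by simp⟩

theorem expandFun_expandFun {T S : NTree n} (σ : T.leaves ≃ S.leaves) (l : T.leaves)
    {a : List (Fin n)} (ha : a ∈ (T.expand l).leaves) :
    expandFun σ.symm (σ l) (expandFun σ l a) = a := by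
  rcases (NTree.mem_leaves_expand l.2 _).1 ha with ⟨ha, hne⟩ | ⟨i, rfl⟩
  · rw [expandFun, expandFun, dif_pos ha, dif_pos (Subtype.property _)]
    simp
  · have : expandFun σ l (l ++ [i]) = σ l ++ [i] := by
      rw [expandFun, dif_neg (append_not_mem l i)]
      simp
    rw [this, expandFun, dif_neg (append_not_mem (σ l) i)]
    simp

theorem exists_simpleExpansionAt (D : TreeDiagram n) (l : D.dom.leaves) :
    ∃ E, D.SimpleExpansionAt l E := by
  refine ⟨⟨D.dom.expand l, D.cod.expand (D.perm l),
    { toFun := fun a => ⟨expandFun D.perm l a, expandFun_mem _ _ a.2⟩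
      invFun := fun b => ⟨expandFun D.perm.symm (D.perm l) b, by
        have := expandFun_mem D.perm.symm (D.perm l) b.2
        rwa [Equiv.symm_apply_apply] at this⟩
      left_inv := fun a => Subtype.ext (expandFun_expandFun _ _ a.2)
      right_inv := fun b => Subtype.ext (by
        have := expandFun_expandFun D.perm.symm (D.perm l) b.2
        rwa [Equiv.symm_symm, Equiv.symm_apply_apply] at this) }⟩, rfl, rfl, ?_, ?_⟩
  · intro k hk
    refine ⟨(NTree.mem_leaves_expand l.2 _).2
      (Or.inl ⟨k.2, fun h => hk (Subtype.ext h)⟩), ?_⟩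
    change expandFun D.perm l k = _
    rw [expandFun, dif_pos k.2]
  · intro i
    refine ⟨(NTree.mem_leaves_expand l.2 _).2 (Or.inr ⟨i, rfl⟩), ?_⟩
    change expandFun D.perm l (l ++ [i]) = _
    rw [expandFun, dif_neg (append_not_mem l i)]
    simp

theorem exists_expands_dom (D : TreeDiagram n) {S : NTree n} (h : D.dom.Expands S) :
    ∃ E, D.Expands E ∧ E.dom = S := by
  induction h with
  | refl => exact ⟨D, Relation.ReflTransGen.refl, rfl⟩
  | tail _ hs ih =>
    obtain ⟨E, hE, rfl⟩ := ih
    obtain ⟨l, hl, rfl⟩ := hs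
    obtain ⟨F, hF⟩ := E.exists_simpleExpansionAt ⟨l, hl⟩
    exact ⟨F, hE.tail ⟨_, hF⟩, hF.1⟩

theorem exists_expands_cod (D : TreeDiagram n) {S : NTree n} (h : D.cod.Expands S) :
    ∃ E, D.Expands E ∧ E.cod = S := by
  obtain ⟨E, hE, rfl⟩ := D.symm.exists_expands_dom h
  exact ⟨E.symm, hE.symm, rfl⟩

/-- Two tree diagrams are equivalent if they have a common expansion. -/
instance setoid (n : ℕ) : Setoid (TreeDiagram n) where
  r D E := ∃ F, D.Expands F ∧ E.Expands F
  iseqv :=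
    { refl := fun D => ⟨D, Relation.ReflTransGen.refl, Relation.ReflTransGen.refl⟩
      symm := fun ⟨F, h1, h2⟩ => ⟨F, h2, h1⟩
      trans := by
        rintro D1 D2 D3 ⟨E, h1, h2⟩ ⟨E', h2', h3⟩
        obtain ⟨R, hR, hR'⟩ := NTree.exists_common_expansion E.dom E'.dom
        obtain ⟨F, hF, hFd⟩ := E.exists_expands_dom hR
        obtain ⟨F', hF', hFd'⟩ := E'.exists_expands_dom hR'
        obtain rfl : F = F' :=
          Expands.eq_of_dom_eq (h2.trans hF) (h2'.trans hF') (hFd.trans hFd'.symm)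
        exact ⟨F, h1.trans hF, h3.trans hF'⟩ }

theorem expands_comp {T T1 T2 S S1 S2 : NTree n} {σ : T1.leaves ≃ T.leaves}
    {σ' : T.leaves ≃ T2.leaves} {τ : S1.leaves ≃ S.leaves} {τ' : S.leaves ≃ S2.leaves}
    (h : Expands ⟨T1, T, σ⟩ ⟨S1, S, τ⟩) (h' : Expands ⟨T, T2, σ'⟩ ⟨S, S2, τ'⟩) :
    Expands ⟨T1, T2, σ.trans σ'⟩ ⟨S1, S2, τ.trans τ'⟩ := by
  obtain ⟨E, hE, hEd⟩ := exists_expands_dom ⟨T1, T2, σ.trans σ'⟩ h.dom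
  suffices E = ⟨S1, S2, τ.trans τ'⟩ from this ▸ hE
  refine ext_maps hEd fun c hc => ?_
  obtain ⟨a, ha, u, rfl⟩ := exists_prefix hE.dom c hc
  refine ⟨_, hE.maps _ _ u (maps_perm ⟨T1, T2, σ.trans σ'⟩ ⟨a, ha⟩) hc, ?_⟩
  have h1 := h.maps _ _ u (maps_perm ⟨T1, T, σ⟩ ⟨a, ha⟩) (hEd ▸ hc)
  have h2 := h'.maps _ _ u (maps_perm ⟨T, T2, σ'⟩ (σ ⟨a, ha⟩)) h1.mem_cod
  obtain ⟨p1, q1⟩ := h1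
  obtain ⟨p2, q2⟩ := h2
  refine ⟨p1, ?_⟩
  change (τ' (τ ⟨a ++ u, p1⟩) : List (Fin n)) = _
  have : τ ⟨a ++ u, p1⟩ = ⟨_, p2⟩ := Subtype.ext q1
  rw [this]
  exact q2

end TreeDiagram

/-! ### The Higman–Thompson group `G_{n,1}` -/

/-- The underlying set of `G_{n,1}`: the `n`-ary tree symbols, i.e. the tree diagrams up to common
expansion. -/
def HigmanThompson (n : ℕ) := Quotient (TreeDiagram.setoid n)

namespace HigmanThompson

variable {n : ℕ}

/-- The tree symbol `[(T₁, T₂, σ)]`. -/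
def symbol (T₁ T₂ : NTree n) (σ : T₁.leaves ≃ T₂.leaves) : HigmanThompson n :=
  Quotient.mk _ ⟨T₁, T₂, σ⟩

theorem symbol_eq_of_expands {T₁ T₂ S₁ S₂ : NTree n} {σ : T₁.leaves ≃ T₂.leaves}
    {τ : S₁.leaves ≃ S₂.leaves} (h : TreeDiagram.Expands ⟨T₁, T₂, σ⟩ ⟨S₁, S₂, τ⟩) :
    symbol T₁ T₂ σ = symbol S₁ S₂ τ :=
  Quotient.sound ⟨_, h, Relation.ReflTransGen.refl⟩

theorem exists_symbol (a : HigmanThompson n) : ∃ T₁ T₂ σ, a = symbol T₁ T₂ σ := by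
  obtain ⟨D, rfl⟩ := Quotient.exists_rep a
  exact ⟨D.dom, D.cod, D.perm, rfl⟩

theorem exists_symbol_dom (T₁ T₂ : NTree n) (σ : T₁.leaves ≃ T₂.leaves) {S : NTree n}
    (h : T₁.Expands S) : ∃ T₂' τ, symbol T₁ T₂ σ = symbol S T₂' τ ∧ T₂.Expands T₂' := by
  obtain ⟨⟨E1, E2, τ⟩, hE, rfl⟩ := TreeDiagram.exists_expands_dom ⟨T₁, T₂, σ⟩ h
  exact ⟨E2, τ, symbol_eq_of_expands hE, hE.symm.dom⟩

theorem exists_symbol_cod (T₁ T₂ : NTree n) (σ : T₁.leaves ≃ T₂.leaves) {S : NTree n}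
    (h : T₂.Expands S) : ∃ T₁' τ, symbol T₁ T₂ σ = symbol T₁' S τ ∧ T₁.Expands T₁' := by
  obtain ⟨⟨E1, E2, τ⟩, hE, rfl⟩ := TreeDiagram.exists_expands_cod ⟨T₁, T₂, σ⟩ h
  exact ⟨E1, τ, symbol_eq_of_expands hE, hE.dom⟩

theorem exists_product (a b : HigmanThompson n) :
    ∃ c : HigmanThompson n, ∃ (T₁ T T₂ : NTree n) (σ : T₁.leaves ≃ T.leaves)
      (σ' : T.leaves ≃ T₂.leaves),
      a = symbol T₁ T σ ∧ b = symbol T T₂ σ' ∧ c = symbol T₁ T₂ (σ.trans σ') := by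
  obtain ⟨A1, A2, α, rfl⟩ := exists_symbol a
  obtain ⟨B1, B2, β, rfl⟩ := exists_symbol b
  obtain ⟨R, hA, hB⟩ := NTree.exists_common_expansion A2 B1
  obtain ⟨A, σ, h1, -⟩ := exists_symbol_cod A1 A2 α hA
  obtain ⟨B, σ', h2, -⟩ := exists_symbol_dom B1 B2 β hB
  exact ⟨_, A, R, B, σ, σ', h1, h2, rfl⟩

theorem product_unique {T T₁ T₂ S S₁ S₂ : NTree n} {σ : T₁.leaves ≃ T.leaves}
    {σ' : T.leaves ≃ T₂.leaves} {τ : S₁.leaves ≃ S.leaves} {τ' : S.leaves ≃ S₂.leaves}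
    (h : symbol T₁ T σ = symbol S₁ S τ) (h' : symbol T T₂ σ' = symbol S S₂ τ') :
    symbol T₁ T₂ (σ.trans σ') = symbol S₁ S₂ (τ.trans τ') := by
  obtain ⟨E, hE1, hE2⟩ := Quotient.exact h
  obtain ⟨F, hF1, hF2⟩ := Quotient.exact h'
  obtain ⟨R, hR1, hR2⟩ := NTree.exists_common_expansion E.cod F.dom
  obtain ⟨⟨E1, R, ε⟩, hE, rfl⟩ := TreeDiagram.exists_expands_cod E hR1
  obtain ⟨⟨R, F2, φ⟩, hF, rfl⟩ := TreeDiagram.exists_expands_dom F hR2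
  exact Quotient.sound ⟨_, TreeDiagram.expands_comp (hE1.trans hE) (hF1.trans hF),
    TreeDiagram.expands_comp (hE2.trans hE) (hF2.trans hF)⟩

/-- The product `[(T₁, T, σ)][(T, T₂, σ')] = [(T₁, T₂, σ · σ')]`, where `σ · σ'` is `σ` followed by
`σ'`; see `symbol_mul_symbol`. -/
noncomputable instance : Mul (HigmanThompson n) := ⟨fun a b => (exists_product a b).choose⟩

theorem symbol_mul_symbol (T₁ T T₂ : NTree n) (σ : T₁.leaves ≃ T.leaves)
    (σ' : T.leaves ≃ T₂.leaves) :
    symbol T₁ T σ * symbol T T₂ σ' = symbol T₁ T₂ (σ.trans σ') := by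
  obtain ⟨S₁, S, S₂, τ, τ', h1, h2, h3⟩ :=
    (exists_product (symbol T₁ T σ) (symbol T T₂ σ')).choose_spec
  exact h3.trans (product_unique h1 h2).symm

/-- The unit `[(T, T, id)]`, with `T` the one-vertex tree; see `one_eq_symbol`. -/
instance : One (HigmanThompson n) := ⟨symbol .leaf .leaf (Equiv.refl _)⟩

theorem one_eq_symbol (T : NTree n) : 1 = symbol T T (Equiv.refl _) := by
  obtain ⟨E, hE, hd⟩ := TreeDiagram.exists_expands_dom
    ⟨NTree.leaf, NTree.leaf, Equiv.refl _⟩ (NTree.leaf_expands T)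
  suffices E = ⟨T, T, Equiv.refl _⟩ from symbol_eq_of_expands (this ▸ hE)
  refine TreeDiagram.ext_maps hd fun c hc => ⟨c, ?_, hd ▸ hc, rfl⟩
  exact hE.maps [] [] c ⟨rfl, rfl⟩ hc

/-- The inverse `[(T₁, T₂, σ)]⁻¹ = [(T₂, T₁, σ⁻¹)]`. -/
instance : Inv (HigmanThompson n) :=
  ⟨Quotient.map TreeDiagram.symm fun _ _ ⟨F, h1, h2⟩ => ⟨F.symm, h1.symm, h2.symm⟩⟩

theorem symbol_inv (T₁ T₂ : NTree n) (σ : T₁.leaves ≃ T₂.leaves) :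
    (symbol T₁ T₂ σ)⁻¹ = symbol T₂ T₁ σ.symm := rfl

/-- The group structure of the Higman–Thompson group `G_{n,1}`. -/
noncomputable instance : Group (HigmanThompson n) :=
  Group.ofLeftAxioms
    (by
      intro a b c
      obtain ⟨_, A, B, C, α, β, rfl, rfl, -⟩ := exists_product a b
      obtain ⟨D, E, γ, rfl⟩ := exists_symbol c
      obtain ⟨R, hC, hD⟩ := NTree.exists_common_expansion C D
      obtain ⟨B', β', h2, hB⟩ := exists_symbol_cod B C β hC
      obtain ⟨A', α', h1, -⟩ := exists_symbol_cod A B α hB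
      obtain ⟨E', γ', h3, -⟩ := exists_symbol_dom D E γ hD
      rw [h1, h2, h3]
      simp only [symbol_mul_symbol, Equiv.trans_assoc])
    (by
      intro a
      obtain ⟨A, B, α, rfl⟩ := exists_symbol a
      rw [one_eq_symbol A, symbol_mul_symbol, Equiv.refl_trans])
    (by
      intro a
      obtain ⟨A, B, α, rfl⟩ := exists_symbol a
      rw [symbol_inv, symbol_mul_symbol, Equiv.symm_trans_self, ← one_eq_symbol])

end HigmanThompson

/-- The `n`-ary tree `T(t)` of a term `t`, obtained by forgetting the variables at the leaves. -/
def CatTerm.tree {n : ℕ} {V : Type*} : CatTerm n V → NTree n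
  | .var _ => .leaf
  | .op ts => .node fun i => (ts i).tree

/-!
A tree symbol `[(T₁, T₂, σ)]` is a rewriting rule for linear terms in disguise: label the leaves of
`T₁` by distinct variables and those of `T₂` accordingly. The proof reads this dictionary in both
directions.

*Seeds.* The equations are linear and balanced, so each generator of the structure monoid has a
linear seed. Linear seeds compose (`IsLinearSeed.exists_mul`): two linear terms over one operation
symbol can always be unified, and the tree of their most general common instance is the least common
expansion of their trees. Hence each element `ρ` has a linear seed, and each other seed is a variant
of it (`IsLinearSeed.of_isSeed`).

*The homomorphism.* Passing from a pair `(s, t)` to a linear instance `(s^φ, t^φ)` expands the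
diagram `(T(s), T(t), π)` and keeps its symbol (`IsSymbolOf.subst`). So all the linear pairs in the
graph of `ρ` have one and the same symbol, and a product is evaluated along
`s ↦ ρ(s) ↦ ρ'(ρ(s))` (`IsLinearTheory.exists_symbolHom`).

*Injectivity.* The structure monoid is closed under inverses, and idempotents are trivial in the
universal group, so each element of the structure group is the class of some `ρ`. If the symbol of
`ρ` is trivial then `ρ` fixes all terms whose tree extends a certain tree `R`. The partial identities
obtained from the transpositions at the inner vertices of `R` have a product `ε` whose domain
consists of such terms; thus `ερ = ε`, and the class of `ρ` is trivial
(`toUniversalGroup_eq_one_of_isSymbolOf_one`).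

*Surjectivity.* A symbol belongs to a pair of linear terms with the same variables, so it is enough
that the structure monoid connects any two terms whose variables agree with multiplicity
(`reach_of_perm`). This is a coherence statement: each term is connected to a left comb
(`exists_reach_comb_var`), and the leaves of a comb may be permuted (`reach_comb_perm`). For the
latter, a transposition of adjacent leaves takes place inside one operation or between two nested
ones, where the exchange of an inner and an outer argument (`reach_opList_exchange`) follows from
symmetry and the catalan equation for the first two positions.
-/

/-! ### Substitution, support and linearity -/

namespace CatTerm

variable {n : ℕ} {V : Type*}

theorem mem_support_var {x y : V} : y ∈ (var x : CatTerm n V).support ↔ y = x := by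
  simp [support, underlyingList]

theorem mem_support_op {ts : Fin n → CatTerm n V} {y : V} :
    y ∈ (op ts).support ↔ ∃ i, y ∈ (ts i).support := by
  simp [support, underlyingList, List.mem_ofFn]

theorem linear_var (x : V) : (var x : CatTerm n V).Linear := by
  simp [Linear, underlyingList]

theorem linear_op {ts : Fin n → CatTerm n V} :
    (op ts).Linear ↔ (∀ i, (ts i).Linear) ∧
      ∀ i j y, y ∈ (ts i).support → y ∈ (ts j).support → i = j := by
  have h1 : (op ts).Linear ↔ (∀ i, (ts i).Linear) ∧
      ∀ i j, i < j → List.Disjoint (ts i).underlyingList (ts j).underlyingList := by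
    simp [Linear, underlyingList, List.nodup_flatten, List.pairwise_ofFn, List.mem_ofFn]
  rw [h1]
  refine and_congr_right fun _ => ⟨fun h i j y hi hj => ?_, fun h i j hij y hi hj => ?_⟩
  · rcases lt_trichotomy i j with hij | hij | hij
    · exact (h i j hij hi hj).elim
    · exact hij
    · exact (h j i hij hj hi).elim
  · exact hij.ne (h i j y hi hj)

theorem support_finite (t : CatTerm n V) : t.support.Finite :=
  List.finite_toSet t.underlyingList

theorem underlyingList_ne_nil (hn : 0 < n) (t : CatTerm n V) : t.underlyingList ≠ [] := by
  induction t with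
  | var x => simp [underlyingList]
  | op ts ih =>
    intro h
    simp only [underlyingList, List.flatten_eq_nil_iff, List.mem_ofFn] at h
    exact ih ⟨0, hn⟩ (h _ ⟨_, rfl⟩)

theorem underlyingList_subst (φ : V → CatTerm n V) (t : CatTerm n V) :
    (t.subst φ).underlyingList = t.underlyingList.flatMap fun y => (φ y).underlyingList := by
  induction t with
  | var x => simp [subst, underlyingList]
  | op ts ih =>
    simp only [subst, underlyingList, ih, List.flatMap_def, List.map_flatten, List.map_ofFn,
      List.flatten_flatten]
    rfl

theorem subst_subst (φ ψ : V → CatTerm n V) (t : CatTerm n V) :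
    (t.subst φ).subst ψ = t.subst fun y => (φ y).subst ψ := by
  induction t with
  | var x => rfl
  | op ts ih => simp [subst, ih]

theorem subst_var (t : CatTerm n V) : t.subst var = t := by
  induction t with
  | var x => rfl
  | op ts ih => simp [subst, ih]

/-- If a substitution instance is linear then so is the term, because no image is empty. -/
theorem Linear.of_subst (hn : 0 < n) {t : CatTerm n V} {φ : V → CatTerm n V}
    (h : (t.subst φ).Linear) : t.Linear := by
  rw [Linear, underlyingList_subst, List.nodup_flatMap] at h
  refine h.2.imp ?_
  rintro a b hab rfl
  obtain ⟨z, hz⟩ := List.exists_mem_of_ne_nil _ (underlyingList_ne_nil hn (φ a))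
  exact hab hz hz

/-- Substitution preserves the relation "same variables with the same multiplicities". -/
theorem perm_subst {s t : CatTerm n V} (h : s.underlyingList.Perm t.underlyingList)
    (φ : V → CatTerm n V) : (s.subst φ).underlyingList.Perm (t.subst φ).underlyingList := by
  rw [underlyingList_subst, underlyingList_subst]
  exact h.flatMap_right _

theorem support_eq_of_perm {s t : CatTerm n V} (h : s.underlyingList.Perm t.underlyingList) :
    s.support = t.support := Set.ext fun _ => h.mem_iff

theorem Linear.of_perm {s t : CatTerm n V} (hs : s.Linear)
    (h : s.underlyingList.Perm t.underlyingList) : t.Linear := h.nodup_iff.1 hs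

theorem Linear.perm {s t : CatTerm n V} (hs : s.Linear) (ht : t.Linear)
    (h : s.support = t.support) : s.underlyingList.Perm t.underlyingList :=
  (List.perm_ext_iff_of_nodup hs ht).2 fun y => Set.ext_iff.1 h y

/-! ### Subterms and leaves -/

theorem sub_nil (t : CatTerm n V) : t.sub [] = some t := by
  cases t <;> rfl

theorem sub_append {t w : CatTerm n V} {a : List (Fin n)} (h : t.sub a = some w)
    (u : List (Fin n)) : t.sub (a ++ u) = w.sub u := by
  induction t generalizing a with
  | var x => cases a <;> simp_all [sub]
  | op ts ih =>
    cases a with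
    | nil => simp_all [sub]
    | cons i a => exact ih i h

theorem sub_subst {t w : CatTerm n V} {a : List (Fin n)} (h : t.sub a = some w)
    (φ : V → CatTerm n V) : (t.subst φ).sub a = some (w.subst φ) := by
  induction t generalizing a with
  | var x => cases a <;> simp_all [sub, sub_nil]
  | op ts ih =>
    cases a with
    | nil =>
      simp only [sub, Option.some.injEq] at h
      rw [← h, sub_nil]
    | cons i a => exact ih i h

theorem mem_leaves_tree {t : CatTerm n V} {a : List (Fin n)} :
    a ∈ t.tree.leaves ↔ ∃ y, t.sub a = some (var y) := by
  induction t generalizing a with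
  | var x => cases a <;> simp [sub, tree, NTree.leaves]
  | op ts ih => cases a <;> simp [sub, tree, NTree.leaves, ih]

theorem mem_support_iff_sub {t : CatTerm n V} {y : V} :
    y ∈ t.support ↔ ∃ a, t.sub a = some (var y) := by
  induction t with
  | var x =>
    rw [mem_support_var]
    constructor
    · rintro rfl
      exact ⟨[], rfl⟩
    · rintro ⟨_ | ⟨i, a⟩, h⟩ <;> simp_all [sub]
  | op ts ih =>
    simp only [mem_support_op, ih]
    constructor
    · rintro ⟨i, a, h⟩
      exact ⟨i :: a, h⟩
    · rintro ⟨_ | ⟨i, a⟩, h⟩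
      · simp [sub] at h
      · exact ⟨i, a, h⟩

theorem Linear.sub_injective {t : CatTerm n V} (ht : t.Linear) {a b : List (Fin n)} {y : V}
    (ha : t.sub a = some (var y)) (hb : t.sub b = some (var y)) : a = b := by
  induction t generalizing a b with
  | var x => cases a <;> cases b <;> simp_all [sub]
  | op ts ih =>
    rw [linear_op] at ht
    rcases a with _ | ⟨i, a⟩
    · simp [sub] at ha
    rcases b with _ | ⟨j, b⟩
    · simp [sub] at hb
    obtain rfl : i = j :=
      ht.2 i j y (mem_support_iff_sub.2 ⟨a, ha⟩) (mem_support_iff_sub.2 ⟨b, hb⟩)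
    rw [ih i (ht.1 i) ha hb]

/-- The leaves of the tree of a linear term correspond to the variables of the term. -/
theorem Linear.exists_leaves_equiv_support {t : CatTerm n V} (ht : t.Linear) :
    ∃ e : t.tree.leaves ≃ t.support, ∀ l : t.tree.leaves, t.sub l = some (var (e l : V)) := by
  choose f hf using fun l : t.tree.leaves => mem_leaves_tree.1 l.2
  refine ⟨Equiv.ofBijective
    (fun l => (⟨f l, mem_support_iff_sub.2 ⟨l, hf l⟩⟩ : t.support)) ⟨fun l m h => ?_, ?_⟩, hf⟩
  · have h' : f l = f m := congrArg Subtype.val h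
    exact Subtype.ext (ht.sub_injective (hf l) (h' ▸ hf m))
  · rintro ⟨y, hy⟩
    obtain ⟨a, ha⟩ := mem_support_iff_sub.1 hy
    have hl : a ∈ t.tree.leaves := mem_leaves_tree.2 ⟨y, ha⟩
    have := hf ⟨a, hl⟩
    refine ⟨⟨a, hl⟩, Subtype.ext ?_⟩
    simpa using this.symm.trans ha

/-- A term is determined by its tree and the labels of the leaves. -/
theorem eq_of_tree_eq {s t : CatTerm n V} (h : s.tree = t.tree)
    (hs : ∀ a ∈ s.tree.leaves, s.sub a = t.sub a) : s = t := by
  induction s generalizing t with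
  | var x =>
    have := hs [] rfl
    rw [sub_nil, sub_nil] at this
    simpa using this
  | op ts ih =>
    cases t with
    | var y => cases h
    | op us =>
      simp only [tree, NTree.node.injEq] at h
      congr 1
      funext i
      exact ih i (congrFun h i) fun a ha => hs (i :: a) ⟨i, a, ha, rfl⟩

/-- The term with a given tree whose leaf at the address `a` carries the variable `lab a`. -/
def ofTree : NTree n → (List (Fin n) → V) → CatTerm n V
  | .leaf, lab => var (lab [])
  | .node ts, lab => op fun i => ofTree (ts i) fun a => lab (i :: a)

theorem tree_ofTree (T : NTree n) (lab : List (Fin n) → V) : (ofTree T lab).tree = T := by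
  induction T generalizing lab with
  | leaf => rfl
  | node ts ih => simp [ofTree, tree, ih]

theorem sub_ofTree {T : NTree n} (lab : List (Fin n) → V) {a : List (Fin n)}
    (ha : a ∈ T.leaves) : (ofTree T lab).sub a = some (var (lab a)) := by
  induction T generalizing lab a with
  | leaf =>
    obtain rfl : a = [] := ha
    rfl
  | node ts ih =>
    obtain ⟨i, v, hv, rfl⟩ := ha
    exact ih i _ hv

theorem mem_support_ofTree {T : NTree n} {lab : List (Fin n) → V} {y : V} :
    y ∈ (ofTree T lab).support ↔ ∃ a ∈ T.leaves, lab a = y := by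
  rw [mem_support_iff_sub]
  constructor
  · rintro ⟨a, ha⟩
    have hl : a ∈ T.leaves := by
      have := mem_leaves_tree.2 ⟨y, ha⟩
      rwa [tree_ofTree] at this
    refine ⟨a, hl, ?_⟩
    simpa [sub_ofTree lab hl] using ha
  · rintro ⟨a, ha, rfl⟩
    exact ⟨a, sub_ofTree lab ha⟩

theorem linear_ofTree {T : NTree n} {lab : List (Fin n) → V} (h : Set.InjOn lab T.leaves) :
    (ofTree T lab).Linear := by
  induction T generalizing lab with
  | leaf => exact linear_var _
  | node ts ih =>
    refine linear_op.2 ⟨fun i => ih i fun a ha b hb hab => ?_, fun i j y hi hj => ?_⟩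
    · simpa using h ⟨i, a, ha, rfl⟩ ⟨i, b, hb, rfl⟩ hab
    · obtain ⟨a, ha, rfl⟩ := mem_support_ofTree.1 hi
      obtain ⟨b, hb, hab⟩ := mem_support_ofTree.1 hj
      have := h ⟨i, a, ha, rfl⟩ ⟨j, b, hb, rfl⟩ hab.symm
      simp_all

theorem exists_linear_tree_eq {x : ℕ → V} (hx : Function.Injective x) (T : NTree n) :
    ∃ t : CatTerm n V, t.Linear ∧ t.tree = T :=
  ⟨ofTree T fun a => x (Encodable.encode a),
    linear_ofTree fun _ _ _ _ h => Encodable.encode_injective (hx h), tree_ofTree _ _⟩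

end CatTerm

/-! ### The order on trees and matching of terms -/

namespace NTree

variable {n : ℕ}

/-- `T.Le S`: the tree `T` is an upper part of `S`. This is the recursive form of
`NTree.Expands`. -/
def Le : NTree n → NTree n → Prop
  | leaf, _ => True
  | node _, leaf => False
  | node ts, node us => ∀ i, (ts i).Le (us i)

theorem Le.refl (T : NTree n) : T.Le T := by
  induction T with
  | leaf => trivial
  | node ts ih => exact ih

theorem Le.trans {T S R : NTree n} (h : T.Le S) (h' : S.Le R) : T.Le R := by
  induction T generalizing S R with
  | leaf => trivial
  | node ts ih =>
    cases S with
    | leaf => cases h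
    | node us =>
      cases R with
      | leaf => cases h'
      | node vs => exact fun i => ih i (h i) (h' i)

theorem Le.expands {T S : NTree n} (h : T.Le S) : T.Expands S := by
  induction T generalizing S with
  | leaf => exact leaf_expands S
  | node ts ih =>
    cases S with
    | leaf => cases h
    | node us => exact expands_node fun i => ih i (h i)

theorem le_expand (T : NTree n) (l : List (Fin n)) : T.Le (T.expand l) := by
  induction T generalizing l with
  | leaf => trivial
  | node ts ih =>
    cases l with
    | nil => exact Le.refl _
    | cons i l =>
      intro j
      by_cases hj : j = i
      · subst hj
        simpa using ih j l
      · simpa [hj] using Le.refl (ts j)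

theorem Expands.le {T S : NTree n} (h : T.Expands S) : T.Le S := by
  induction h with
  | refl => exact Le.refl T
  | tail _ hs ih =>
    obtain ⟨l, -, rfl⟩ := hs
    exact ih.trans (le_expand _ l)

theorem exists_lub (T S : NTree n) :
    ∃ R : NTree n, T.Le R ∧ S.Le R ∧ ∀ W : NTree n, T.Le W → S.Le W → R.Le W := by
  induction T generalizing S with
  | leaf => exact ⟨S, trivial, Le.refl S, fun W _ h => h⟩
  | node ts ih =>
    cases S with
    | leaf => exact ⟨node ts, Le.refl _, trivial, fun W h _ => h⟩
    | node us =>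
      choose R h1 h2 h3 using fun i => ih i (us i)
      refine ⟨node R, h1, h2, fun W hT hS => ?_⟩
      cases W with
      | leaf => cases hT
      | node ws => exact fun i => h3 i _ (hT i) (hS i)

end NTree

namespace CatTerm

variable {n : ℕ} {V : Type*}

theorem tree_le_subst (t : CatTerm n V) (φ : V → CatTerm n V) : t.tree.Le (t.subst φ).tree := by
  induction t with
  | var x => trivial
  | op ts ih => exact ih

/-- A linear term matches each term whose tree extends its own. -/
theorem Linear.exists_subst_eq {t r : CatTerm n V} (ht : t.Linear) (h : t.tree.Le r.tree) :
    ∃ φ, t.subst φ = r := by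
  classical
  induction t generalizing r with
  | var x => exact ⟨fun _ => r, rfl⟩
  | op ts ih =>
    cases r with
    | var y => cases h
    | op rs =>
      rw [linear_op] at ht
      choose φ hφ using fun i => ih i (ht.1 i) (h i)
      refine ⟨fun y => if hy : ∃ i, y ∈ (ts i).support then φ hy.choose y else var y, ?_⟩
      simp only [subst, op.injEq]
      funext i
      rw [← hφ i]
      refine subst_congr _ _ _ fun y hy => ?_
      have hy' : ∃ i, y ∈ (ts i).support := ⟨i, hy⟩
      rw [dif_pos hy', ht.2 _ _ y hy'.choose_spec hy]

end CatTerm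

/-! ### The tree symbol of a pair of terms -/

/-- The bijection `σ` sends each leaf of the tree of `s` to a leaf of the tree of `t` with the same
variable. -/
def PreservesLabels {n : ℕ} {V : Type*} {s t : CatTerm n V}
    (σ : s.tree.leaves ≃ t.tree.leaves) : Prop :=
  ∀ l : s.tree.leaves, t.sub (σ l) = s.sub l

/-- `g` is the tree symbol `[(T(s), T(t), π)]` with `π` preserving the labels of the leaves. -/
def IsSymbolOf {n : ℕ} {V : Type*} (g : HigmanThompson n) (s t : CatTerm n V) : Prop :=
  ∃ σ : s.tree.leaves ≃ t.tree.leaves, PreservesLabels σ ∧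
    g = HigmanThompson.symbol s.tree t.tree σ

section Symbol

open CatTerm

variable {n : ℕ} {V : Type*} {s t u : CatTerm n V}

theorem CatTerm.Linear.exists_preservesLabels (hs : s.Linear) (ht : t.Linear)
    (h : s.support = t.support) : ∃ σ : s.tree.leaves ≃ t.tree.leaves, PreservesLabels σ := by
  obtain ⟨e, he⟩ := hs.exists_leaves_equiv_support
  obtain ⟨f, hf⟩ := ht.exists_leaves_equiv_support
  refine ⟨(e.trans (Equiv.setCongr h)).trans f.symm, fun l => ?_⟩
  rw [hf, he]
  simp

theorem CatTerm.Linear.exists_isSymbolOf (hs : s.Linear) (ht : t.Linear)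
    (h : s.support = t.support) : ∃ g, IsSymbolOf g s t := by
  obtain ⟨σ, hσ⟩ := hs.exists_preservesLabels ht h
  exact ⟨_, σ, hσ, rfl⟩

theorem IsSymbolOf.unique (ht : t.Linear) {g h : HigmanThompson n} (hg : IsSymbolOf g s t)
    (hh : IsSymbolOf h s t) : g = h := by
  obtain ⟨σ, hσ, rfl⟩ := hg
  obtain ⟨τ, hτ, rfl⟩ := hh
  suffices σ = τ by rw [this]
  ext l : 2
  obtain ⟨y, hy⟩ := mem_leaves_tree.1 l.2
  exact ht.sub_injective ((hσ l).trans hy) ((hτ l).trans hy)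

theorem IsSymbolOf.mul {g h : HigmanThompson n} (hg : IsSymbolOf g s t)
    (hh : IsSymbolOf h t u) : IsSymbolOf (g * h) s u := by
  obtain ⟨σ, hσ, rfl⟩ := hg
  obtain ⟨τ, hτ, rfl⟩ := hh
  exact ⟨σ.trans τ, fun l => (hτ (σ l)).trans (hσ l), HigmanThompson.symbol_mul_symbol ..⟩

/-- The expansion of the diagram of `(s, t)` to the tree of an instance `s^φ` is the diagram of
`(s^φ, t^φ)`. -/
theorem PreservesLabels.expands_eq {φ : V → CatTerm n V} {σ : s.tree.leaves ≃ t.tree.leaves}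
    (hσ : PreservesLabels σ) {τ : (s.subst φ).tree.leaves ≃ (t.subst φ).tree.leaves}
    (hτ : PreservesLabels τ) (hl : (t.subst φ).Linear) {E : TreeDiagram n}
    (hE : TreeDiagram.Expands ⟨s.tree, t.tree, σ⟩ E) (hd : E.dom = (s.subst φ).tree) :
    E = ⟨(s.subst φ).tree, (t.subst φ).tree, τ⟩ := by
  refine TreeDiagram.ext_maps hd fun c hc => ?_
  obtain ⟨a, ha, v, rfl⟩ := TreeDiagram.exists_prefix hE.dom c hc
  have hc' : a ++ v ∈ (s.subst φ).tree.leaves := by rwa [← hd]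
  refine ⟨_, hE.maps _ _ v (TreeDiagram.maps_perm ⟨s.tree, t.tree, σ⟩ ⟨a, ha⟩) hc, hc', ?_⟩
  change (τ ⟨a ++ v, hc'⟩ : List (Fin n)) = σ ⟨a, ha⟩ ++ v
  obtain ⟨y, hy⟩ := mem_leaves_tree.1 ha
  obtain ⟨z, hz⟩ := mem_leaves_tree.1 hc'
  refine hl.sub_injective ((hτ _).trans hz) ?_
  rw [sub_append (sub_subst ((hσ ⟨a, ha⟩).trans hy) φ), ← sub_append (sub_subst hy φ), hz]

theorem IsSymbolOf.subst {g : HigmanThompson n} (hg : IsSymbolOf g s t) {φ : V → CatTerm n V}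
    (hs : (s.subst φ).Linear) (ht : (t.subst φ).Linear)
    (h : (s.subst φ).support = (t.subst φ).support) :
    IsSymbolOf g (s.subst φ) (t.subst φ) := by
  obtain ⟨σ, hσ, rfl⟩ := hg
  obtain ⟨τ, hτ⟩ := hs.exists_preservesLabels ht h
  obtain ⟨E, hE, hd⟩ := TreeDiagram.exists_expands_dom ⟨s.tree, t.tree, σ⟩
    (tree_le_subst s φ).expands
  obtain rfl := hσ.expands_eq hτ ht hE hd
  exact ⟨τ, hτ, HigmanThompson.symbol_eq_of_expands hE⟩

/-- If the tree symbol of a linear pair is trivial then the two terms have a common linear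
instance under one and the same substitution. -/
theorem IsSymbolOf.exists_subst_eq {x : ℕ → V} (hx : Function.Injective x) (hs : s.Linear)
    (h : s.underlyingList.Perm t.underlyingList) (hg : IsSymbolOf 1 s t) :
    ∃ φ, (s.subst φ).Linear ∧ s.subst φ = t.subst φ := by
  obtain ⟨σ, hσ, h1⟩ := hg
  obtain ⟨F, hF, hF'⟩ := Quotient.exact h1
  obtain ⟨r, hr, hrF⟩ := exists_linear_tree_eq hx F.dom
  obtain ⟨φ, rfl⟩ := hs.exists_subst_eq (by rw [hrF]; exact hF'.dom.le)
  have hp := perm_subst h φ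
  obtain ⟨τ, hτ⟩ := hr.exists_preservesLabels (hr.of_perm hp) (support_eq_of_perm hp)
  obtain rfl := hσ.expands_eq hτ (hr.of_perm hp) hF' hrF.symm
  have key : ∀ l, (τ l : List (Fin n)) = l := fun l => by
    have := hF.maps [] [] l ⟨rfl, rfl⟩ l.2
    exact this.2
  have ht : (s.subst φ).tree = (t.subst φ).tree := by
    apply NTree.leaves_injective
    ext a
    constructor
    · intro ha
      have := (τ ⟨a, ha⟩).2
      rwa [key] at this
    · intro ha
      have := key (τ.symm ⟨a, ha⟩)
      rw [Equiv.apply_symm_apply] at this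
      rw [show a = _ from this]
      exact (τ.symm ⟨a, ha⟩).2
  refine ⟨φ, hr, eq_of_tree_eq ht fun a ha => ?_⟩
  have := hτ ⟨a, ha⟩
  rw [key] at this
  exact this.symm

end Symbol

/-! ### Seeds of the elements of the structure monoid -/

section Seeds

open CatTerm

variable {n : ℕ} {V : Type*}

theorem PartialEndo.mem_mul {X : Type*} {f g : PartialEndo X} {u v : X} :
    v ∈ (f * g) u ↔ ∃ w, w ∈ f u ∧ v ∈ g w :=
  Part.mem_bind_iff

theorem PartialEndo.mem_one {X : Type*} {u v : X} : v ∈ (1 : PartialEndo X) u ↔ v = u :=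
  Part.mem_some_iff

theorem PartialEndo.ext {X : Type*} {f g : PartialEndo X} (h : ∀ u v, v ∈ f u ↔ v ∈ g u) :
    f = g :=
  PFun.ext h

/-- A linear seed: a seed consisting of two linear terms with the same variables. -/
structure IsLinearSeed (ρ : PartialEndo (CatTerm n V)) (s t : CatTerm n V) : Prop where
  isSeed : IsSeed ρ s t
  left : s.Linear
  right : t.Linear
  support_eq : s.support = t.support

theorem IsLinearSeed.perm {ρ : PartialEndo (CatTerm n V)} {s t : CatTerm n V}
    (h : IsLinearSeed ρ s t) : s.underlyingList.Perm t.underlyingList :=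
  h.left.perm h.right h.support_eq

theorem IsSeed.mem {ρ : PartialEndo (CatTerm n V)} {s t : CatTerm n V} (h : IsSeed ρ s t)
    (φ : V → CatTerm n V) : t.subst φ ∈ ρ (s.subst φ) := (h _ _).2 ⟨φ, rfl, rfl⟩

theorem IsSeed.mem_self {ρ : PartialEndo (CatTerm n V)} {s t : CatTerm n V} (h : IsSeed ρ s t) :
    t ∈ ρ s := by
  simpa only [subst_var] using h.mem var

/-- A partial map with a linear seed preserves the variables of a term and their multiplicities. -/
theorem IsLinearSeed.perm_of_mem {ρ : PartialEndo (CatTerm n V)} {s t : CatTerm n V}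
    (h : IsLinearSeed ρ s t) {u v : CatTerm n V} (huv : v ∈ ρ u) :
    u.underlyingList.Perm v.underlyingList := by
  obtain ⟨φ, rfl, rfl⟩ := (h.isSeed u v).1 huv
  exact perm_subst h.perm φ

/-- If one seed is linear then so is each other one: it is an instance of the linear seed, and the
linear seed is an instance of it. -/
theorem IsLinearSeed.of_isSeed (hn : 0 < n) {ρ : PartialEndo (CatTerm n V)}
    {s t s' t' : CatTerm n V} (h : IsLinearSeed ρ s t) (h' : IsSeed ρ s' t') : IsLinearSeed ρ s' t' := by
  have hp := h.perm_of_mem h'.mem_self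
  obtain ⟨φ, rfl, -⟩ := (h' s t).1 h.isSeed.mem_self
  have hs := h.left.of_subst hn
  exact ⟨h', hs, hs.of_perm hp, support_eq_of_perm hp⟩

theorem isLinearSeed_one (y : V) : IsLinearSeed (1 : PartialEndo (CatTerm n V)) (var y) (var y) :=
  ⟨fun u _ => PartialEndo.mem_one.trans
    ⟨fun h => ⟨fun _ => u, rfl, h⟩, fun ⟨_, h1, h2⟩ => h2.trans h1.symm⟩,
    linear_var y, linear_var y, rfl⟩

/-- The composite of two partial maps with linear seeds has a linear seed: since there is just one
operation symbol, the linear terms `t` and `s'` can always be unified, and the most general common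
instance is a linear term whose tree is the least common expansion of the two trees. -/
theorem IsLinearSeed.exists_mul {x : ℕ → V} (hx : Function.Injective x)
    {f g : PartialEndo (CatTerm n V)} {s t s' t' : CatTerm n V}
    (hf : IsLinearSeed f s t) (hg : IsLinearSeed g s' t') :
    ∃ p q, IsLinearSeed (f * g) p q := by
  obtain ⟨R, hR1, hR2, hR⟩ := NTree.exists_lub t.tree s'.tree
  obtain ⟨r, hr, rfl⟩ := exists_linear_tree_eq hx R
  obtain ⟨φ, hφ⟩ := hf.right.exists_subst_eq hR1
  obtain ⟨ψ, hψ⟩ := hg.left.exists_subst_eq hR2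
  have hp := perm_subst hf.perm φ
  have hq := perm_subst hg.perm ψ
  rw [hφ] at hp
  rw [hψ] at hq
  refine ⟨s.subst φ, t'.subst ψ, fun u v => PartialEndo.mem_mul.trans ⟨?_, ?_⟩,
    hr.of_perm hp.symm, hr.of_perm hq, support_eq_of_perm (hp.trans hq)⟩
  · rintro ⟨w, hw1, hw2⟩
    obtain ⟨α, rfl, rfl⟩ := (hf.isSeed _ _).1 hw1
    obtain ⟨β, hβ, rfl⟩ := (hg.isSeed _ _).1 hw2
    obtain ⟨θ, hθ⟩ := hr.exists_subst_eq
      (hR _ (tree_le_subst t α) (hβ ▸ tree_le_subst s' β))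
    refine ⟨θ, ?_, ?_⟩
    · rw [subst_subst]
      refine subst_congr _ _ _ fun y hy => ?_
      refine eq_of_subst_eq α (fun y => (φ y).subst θ) t ?_ y (hf.support_eq ▸ hy)
      rw [← subst_subst, hφ, hθ]
    · rw [subst_subst]
      refine subst_congr _ _ _ fun y hy => ?_
      refine eq_of_subst_eq β (fun y => (ψ y).subst θ) s' ?_ y (hg.support_eq ▸ hy)
      rw [← subst_subst, hψ, hθ, hβ]
  · rintro ⟨θ, rfl, rfl⟩
    refine ⟨r.subst θ, ?_, ?_⟩
    · have := hf.isSeed.mem fun y => (φ y).subst θ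
      rwa [← subst_subst, ← subst_subst, hφ] at this
    · have := hg.isSeed.mem fun y => (ψ y).subst θ
      rwa [← subst_subst, ← subst_subst, hψ] at this

/-! ### Translated copies -/

/-- The translated copy of `f` as an element of the monoid of partial maps. -/
def translateAt (f : PartialEndo (CatTerm n V)) (α : List (Fin n)) : PartialEndo (CatTerm n V) :=
  translatedCopy f α

theorem translateAt_nil (f : PartialEndo (CatTerm n V)) : translateAt f [] = f := by
  funext u
  cases u <;> rfl

theorem translateAt_cons (f : PartialEndo (CatTerm n V)) (i : Fin n) (α : List (Fin n)) :
    translateAt f (i :: α) = translateAt (translateAt f α) [i] := by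
  funext u
  cases u <;> rfl

theorem mem_translateAt_singleton {f : PartialEndo (CatTerm n V)} {i : Fin n}
    {u v : CatTerm n V} : v ∈ translateAt f [i] u ↔
      ∃ ts w, u = op ts ∧ w ∈ f (ts i) ∧ v = op (Function.update ts i w) := by
  change v ∈ translatedCopy f [i] u ↔ _
  cases u with
  | var y => simp [translatedCopy]
  | op ts =>
    simp only [translatedCopy, Part.mem_map_iff, op.injEq]
    constructor
    · rintro ⟨w, hw, rfl⟩
      exact ⟨ts, w, rfl, hw, rfl⟩
    · rintro ⟨_, w, rfl, hw, rfl⟩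
      exact ⟨w, hw, rfl⟩

theorem translateAt_singleton_mul (f g : PartialEndo (CatTerm n V)) (i : Fin n) :
    translateAt (f * g) [i] = translateAt f [i] * translateAt g [i] := by
  refine PartialEndo.ext fun u v => ?_
  simp only [PartialEndo.mem_mul, mem_translateAt_singleton]
  constructor
  · rintro ⟨ts, w, rfl, ⟨z, hz, hw⟩, rfl⟩
    exact ⟨_, ⟨ts, z, rfl, hz, rfl⟩, _, w, rfl, by simpa using hw, by simp⟩
  · rintro ⟨_, ⟨ts, z, rfl, hz, rfl⟩, ts', w, h, hw, rfl⟩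
    obtain rfl := op.inj h
    exact ⟨ts, w, rfl, ⟨z, hz, by simpa using hw⟩, by simp⟩

/-- The seed of a translated copy puts the terms of the given seed into the same context of fresh
variables. -/
theorem IsLinearSeed.exists_translateAt_singleton [Infinite V] {f : PartialEndo (CatTerm n V)}
    {s t : CatTerm n V} (h : IsLinearSeed f s t) (i : Fin n) :
    ∃ p q, IsLinearSeed (translateAt f [i]) p q := by
  obtain ⟨e⟩ : Nonempty (ℕ ↪ (s.supportᶜ : Set V)) :=
    ⟨(s.support_finite.infinite_compl).natEmbedding⟩
  set y : Fin n → V := fun j => e j with hy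
  have hy1 : ∀ j, y j ∉ s.support := fun j => (e j).2
  have hy2 : Function.Injective y := fun j k hjk =>
    Fin.ext (e.injective (Subtype.ext hjk))
  have lin : ∀ w : CatTerm n V, w.Linear → s.support = w.support →
      (op (Function.update (fun j => var (y j)) i w)).Linear := by
    intro w hw hs
    refine linear_op.2 ⟨fun j => ?_, fun j k z hj hk => ?_⟩
    · by_cases hj : j = i
      · subst hj
        simpa using hw
      · simpa [hj] using linear_var _
    · by_cases hji : j = i <;> by_cases hki : k = i
      · exact hji.trans hki.symm
      · subst hji
        simp only [Function.update_self, ne_eq, hki, not_false_eq_true, Function.update_of_ne,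
          mem_support_var] at hj hk
        exact (hy1 k (hs ▸ hk ▸ hj)).elim
      · subst hki
        simp only [Function.update_self, ne_eq, hji, not_false_eq_true, Function.update_of_ne,
          mem_support_var] at hj hk
        exact (hy1 j (hs ▸ hj ▸ hk)).elim
      · simp only [ne_eq, hji, hki, not_false_eq_true, Function.update_of_ne,
          mem_support_var] at hj hk
        exact hy2 (hj.symm.trans hk)
  refine ⟨_, _, fun u v => ?_, lin s h.left rfl, lin t h.right h.support_eq, ?_⟩
  · rw [mem_translateAt_singleton]
    constructor
    · rintro ⟨ts, w, rfl, hw, rfl⟩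
      have hle : (op (Function.update (fun j => var (y j)) i s)).tree.Le (op ts).tree := by
        intro j
        by_cases hj : j = i
        · subst hj
          obtain ⟨φ, hφ, -⟩ := (h.isSeed _ _).1 hw
          simpa [hφ] using tree_le_subst s φ
        · simp only [ne_eq, hj, not_false_eq_true, Function.update_of_ne]
          trivial
      obtain ⟨φ, hφ⟩ := (lin s h.left rfl).exists_subst_eq hle
      refine ⟨φ, hφ.symm, ?_⟩
      simp only [subst, op.injEq] at hφ ⊢
      funext j
      have hφj := congrFun hφ j
      by_cases hj : j = i
      · subst hj
        simp only [Function.update_self] at hφj ⊢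
        rw [← hφj] at hw
        exact Part.mem_unique hw (h.isSeed.mem φ)
      · simpa [hj] using hφj.symm
    · rintro ⟨φ, rfl, rfl⟩
      refine ⟨_, t.subst φ, rfl, by simpa using h.isSeed.mem φ, ?_⟩
      simp only [subst, op.injEq]
      funext j
      by_cases hj : j = i
      · subst hj
        simp
      · simp [hj]
  · ext z
    simp only [mem_support_op]
    refine exists_congr fun j => ?_
    by_cases hj : j = i
    · subst hj
      simp [h.support_eq]
    · simp [hj]

/-! ### Structure monoids of linear balanced theories -/

variable {E : Set (CatTerm n V × CatTerm n V)}

/-- The equations are linear and balanced: no variable occurs twice in a side, and both sides have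
the same variables. -/
def IsLinearTheory (E : Set (CatTerm n V × CatTerm n V)) : Prop :=
  ∀ s t, (s, t) ∈ E → s.Linear ∧ t.Linear ∧ s.support = t.support

theorem IsLinearTheory.isLinearSeed (hE : IsLinearTheory E) {s t : CatTerm n V}
    (h : (s, t) ∈ E ∨ (t, s) ∈ E) : IsLinearSeed (basicOperator s t) s t := by
  have : s.Linear ∧ t.Linear ∧ s.support = t.support := by
    rcases h with h | h
    · exact hE s t h
    · obtain ⟨h1, h2, h3⟩ := hE t s h
      exact ⟨h2, h1, h3.symm⟩
  exact ⟨mem_basicOperator this.2.2, this.1, this.2.1, this.2.2⟩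

theorem IsLinearTheory.exists_isLinearSeed (hE : IsLinearTheory E) {x : ℕ → V}
    (hx : Function.Injective x) {ρ : PartialEndo (CatTerm n V)} (hρ : ρ ∈ structureMonoid E) :
    ∃ s t, IsLinearSeed ρ s t := by
  have : Infinite V := Infinite.of_injective x hx
  induction hρ using Submonoid.closure_induction with
  | mem f hf =>
    obtain ⟨s, t, α, h, rfl⟩ := hf
    change ∃ p q, IsLinearSeed (translateAt (basicOperator s t) α) p q
    induction α with
    | nil => exact ⟨s, t, (translateAt_nil _).symm ▸ hE.isLinearSeed h⟩
    | cons i α ih =>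
      obtain ⟨p, q, hpq⟩ := ih
      rw [translateAt_cons]
      exact hpq.exists_translateAt_singleton i
  | one => exact ⟨_, _, isLinearSeed_one (x 0)⟩
  | mul f g _ _ hf hg =>
    obtain ⟨s, t, h⟩ := hf
    obtain ⟨s', t', h'⟩ := hg
    exact h.exists_mul hx h'

/-- The structure monoid contains the inverse of each of its elements, which are injective partial
maps. -/
theorem IsLinearTheory.exists_inverse (hE : IsLinearTheory E) {ρ : PartialEndo (CatTerm n V)}
    (hρ : ρ ∈ structureMonoid E) :
    ∃ ρ' ∈ structureMonoid E, ∀ u v, v ∈ ρ u ↔ u ∈ ρ' v := by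
  induction hρ using Submonoid.closure_induction with
  | mem f hf =>
    obtain ⟨s, t, α, h, rfl⟩ := hf
    refine ⟨_, Submonoid.subset_closure ⟨t, s, α, h.symm, rfl⟩, ?_⟩
    change ∀ u v, v ∈ translateAt (basicOperator s t) α u ↔ u ∈ translateAt (basicOperator t s) α v
    induction α with
    | nil =>
      intro u v
      have h1 := (hE.isLinearSeed h).isSeed u v
      have h2 := (hE.isLinearSeed h.symm).isSeed v u
      rw [translateAt_nil, translateAt_nil, h1, h2]
      simp only [and_comm]
    | cons i α ih =>
      intro u v
      rw [translateAt_cons (basicOperator s t), translateAt_cons (basicOperator t s),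
        mem_translateAt_singleton, mem_translateAt_singleton]
      constructor
      · rintro ⟨ts, w, rfl, hw, rfl⟩
        exact ⟨_, ts i, rfl, by simpa using (ih _ _).1 hw, by simp⟩
      · rintro ⟨ts, w, rfl, hw, rfl⟩
        exact ⟨_, ts i, rfl, by simpa using (ih _ _).2 hw, by simp⟩
  | one => exact ⟨1, one_mem _, fun u v => by simp only [PartialEndo.mem_one, eq_comm]⟩
  | mul f g _ _ hf hg =>
    obtain ⟨f', hf', hff'⟩ := hf
    obtain ⟨g', hg', hgg'⟩ := hg
    refine ⟨g' * f', mul_mem hg' hf', fun u v => ?_⟩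
    simp only [PartialEndo.mem_mul, hff', hgg', and_comm]

end Seeds

/-! ### The symmetric catalan theory -/

section Theory

open CatTerm

variable {n : ℕ} {V : Type*} {x : ℕ → V}

theorem linear_op_var {y : Fin n → V} (hy : Function.Injective y) :
    (op fun k => var (y k) : CatTerm n V).Linear :=
  linear_op.2 ⟨fun _ => linear_var _, fun _ _ _ hi hj =>
    hy ((mem_support_var.1 hi).symm.trans (mem_support_var.1 hj))⟩

theorem linear_catalanTerm (hx : Function.Injective x) (j : ℕ) :
    (catalanTerm n x j).Linear := by
  refine linear_op.2 ⟨fun k => ?_, fun k l z hk hl => ?_⟩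
  · split_ifs
    · exact linear_var _
    · exact linear_op_var fun a b hab => Fin.ext (by simpa using hx hab)
    · exact linear_var _
  · have hn : 0 < n := k.pos
    apply Fin.ext
    split_ifs at hk hl <;> simp only [mem_support_op, mem_support_var] at hk hl
    all_goals
      obtain ⟨a, rfl⟩ := hk
      first
      | obtain ⟨b, hl⟩ := hl
        have := hx hl
        omega
      | have := hx hl
        omega

/-- The variables of the term are `x_0, …, x_{2n-2}`, wherever the inner operation is. -/
theorem mem_support_catalanTerm {j : ℕ} (hj : j < n) {z : V} :
    z ∈ (catalanTerm n x j).support ↔ ∃ k, k < 2 * n - 1 ∧ z = x k := by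
  rw [catalanTerm, mem_support_op]
  constructor
  · rintro ⟨k, hk⟩
    have := k.2
    split_ifs at hk
    · exact ⟨k, by omega, mem_support_var.1 hk⟩
    · obtain ⟨m, hm⟩ := mem_support_op.1 hk
      exact ⟨j + m, by omega, mem_support_var.1 hm⟩
    · exact ⟨k + n - 1, by omega, mem_support_var.1 hk⟩
  · rintro ⟨k, hk, rfl⟩
    rcases lt_or_ge k j with h | h
    · refine ⟨⟨k, by omega⟩, ?_⟩
      rw [if_pos h]
      exact mem_support_var.2 rfl
    rcases lt_or_ge k (j + n) with h' | h'
    · refine ⟨⟨j, hj⟩, ?_⟩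
      rw [if_neg (lt_irrefl j), if_pos rfl]
      refine mem_support_op.2 ⟨⟨k - j, by omega⟩, mem_support_var.2 ?_⟩
      congr 1
      change k = j + (k - j)
      omega
    · refine ⟨⟨k + 1 - n, by omega⟩, ?_⟩
      rw [if_neg (by simp only; omega), if_neg (by simp only; omega), mem_support_var]
      congr 1
      simp only
      omega

theorem swap_lt {i k : ℕ} (hi : i + 1 < n) (hk : k < n) : Equiv.swap i (i + 1) k < n := by
  rw [Equiv.swap_apply_def]
  split_ifs <;> omega

theorem isLinearTheory_symmetricCatalanEquations (hx : Function.Injective x) :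
    IsLinearTheory (symmetricCatalanEquations n x) := by
  rintro s t (⟨i, hi, hin, h⟩ | ⟨i, hi, h⟩)
  · obtain ⟨rfl, rfl⟩ := Prod.mk.inj h
    refine ⟨linear_catalanTerm hx _, linear_catalanTerm hx _, Set.ext fun z => ?_⟩
    rw [mem_support_catalanTerm hin, mem_support_catalanTerm (by omega)]
  · obtain ⟨rfl, rfl⟩ := Prod.mk.inj h
    refine ⟨linear_op_var fun a b hab => Fin.ext (hx hab),
      linear_op_var fun a b hab => Fin.ext ((Equiv.swap _ _).injective (hx hab)),
      Set.ext fun z => ?_⟩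
    simp only [mem_support_op, mem_support_var]
    constructor
    · rintro ⟨k, rfl⟩
      exact ⟨⟨_, swap_lt hi k.2⟩, by simp⟩
    · rintro ⟨k, rfl⟩
      exact ⟨⟨_, swap_lt hi k.2⟩, rfl⟩

end Theory

/-! ### Terms connected by the structure monoid -/

section Coherence

open CatTerm

variable {n : ℕ} {V : Type*} {x : ℕ → V}

/-- The partial identity on the terms that are not variables belongs to the structure monoid: it is
the transposition of the first two arguments followed by its inverse. -/
theorem exists_partial_identity_op (hn : 2 ≤ n) (hx : Function.Injective x) :
    ∃ ε ∈ structureMonoid (symmetricCatalanEquations n x),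
      ∀ u v : CatTerm n V, v ∈ ε u ↔ v = u ∧ ∃ ts, u = op ts := by
  set s : CatTerm n V := op fun k => var (x k) with hs
  set t : CatTerm n V := op fun k => var (x (Equiv.swap 0 (0 + 1) (k : ℕ))) with ht
  have hE : (s, t) ∈ symmetricCatalanEquations n x := Or.inr ⟨0, by omega, rfl⟩
  have h1 := (isLinearTheory_symmetricCatalanEquations hx).isLinearSeed (Or.inl hE)
  have h2 := (isLinearTheory_symmetricCatalanEquations hx).isLinearSeed (Or.inr hE)
  refine ⟨basicOperator s t * basicOperator t s, mul_mem
    (Submonoid.subset_closure ⟨s, t, [], Or.inl hE, (translateAt_nil _).symm⟩)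
    (Submonoid.subset_closure ⟨t, s, [], Or.inr hE, (translateAt_nil _).symm⟩),
    fun u v => PartialEndo.mem_mul.trans ⟨?_, ?_⟩⟩
  · rintro ⟨w, hw, hv⟩
    obtain ⟨φ, rfl, rfl⟩ := (h1.isSeed _ _).1 hw
    exact ⟨Part.mem_unique hv (h2.isSeed.mem φ), _, rfl⟩
  · rintro ⟨rfl, ts, rfl⟩
    have hle : s.tree.Le (op ts).tree := fun _ => trivial
    obtain ⟨φ, hφ⟩ := h1.left.exists_subst_eq hle
    rw [← hφ]
    exact ⟨_, h1.isSeed.mem φ, h2.isSeed.mem φ⟩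

theorem translateAt_singleton_mem (hn : 2 ≤ n) (hx : Function.Injective x)
    {ρ : PartialEndo (CatTerm n V)} (hρ : ρ ∈ structureMonoid (symmetricCatalanEquations n x))
    (i : Fin n) : translateAt ρ [i] ∈ structureMonoid (symmetricCatalanEquations n x) := by
  induction hρ using Submonoid.closure_induction with
  | mem f hf =>
    obtain ⟨s, t, α, h, rfl⟩ := hf
    exact Submonoid.subset_closure
      ⟨s, t, i :: α, h, (translateAt_cons (basicOperator s t) i α).symm⟩
  | one =>
    -- The translated unit is not the unit: its domain consists of the terms that are not variables.
    obtain ⟨ε, hε, h⟩ := exists_partial_identity_op hn hx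
    suffices translateAt 1 [i] = ε from this ▸ hε
    refine PartialEndo.ext fun u v => ?_
    rw [h, mem_translateAt_singleton]
    constructor
    · rintro ⟨ts, w, rfl, hw, rfl⟩
      rw [PartialEndo.mem_one.1 hw, Function.update_eq_self]
      exact ⟨rfl, ts, rfl⟩
    · rintro ⟨rfl, ts, rfl⟩
      exact ⟨ts, ts i, rfl, PartialEndo.mem_one.2 rfl, by simp⟩
  | mul f g _ _ hf hg =>
    rw [translateAt_singleton_mul]
    exact mul_mem hf hg

/-- Some element of the structure monoid of symmetric catalan algebras sends `s` to `t`. -/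
def Reach (x : ℕ → V) (s t : CatTerm n V) : Prop :=
  ∃ ρ ∈ structureMonoid (symmetricCatalanEquations n x), t ∈ ρ s

theorem Reach.refl (s : CatTerm n V) : Reach x s s :=
  ⟨1, one_mem _, PartialEndo.mem_one.2 rfl⟩

theorem Reach.trans {s t u : CatTerm n V} (h : Reach x s t) (h' : Reach x t u) : Reach x s u := by
  obtain ⟨ρ, hρ, h⟩ := h
  obtain ⟨σ, hσ, h'⟩ := h'
  exact ⟨ρ * σ, mul_mem hρ hσ, PartialEndo.mem_mul.2 ⟨t, h, h'⟩⟩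

theorem Reach.symm (hx : Function.Injective x) {s t : CatTerm n V} (h : Reach x s t) :
    Reach x t s := by
  obtain ⟨ρ, hρ, h⟩ := h
  obtain ⟨ρ', hρ', h'⟩ :=
    (isLinearTheory_symmetricCatalanEquations hx).exists_inverse hρ
  exact ⟨ρ', hρ', (h' _ _).1 h⟩

theorem Reach.op_update (hn : 2 ≤ n) (hx : Function.Injective x) {ts : Fin n → CatTerm n V}
    {i : Fin n} {w : CatTerm n V} (h : Reach x (ts i) w) :
    Reach x (op ts) (op (Function.update ts i w)) := by
  obtain ⟨ρ, hρ, h⟩ := h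
  exact ⟨_, translateAt_singleton_mem hn hx hρ i,
    mem_translateAt_singleton.2 ⟨ts, w, rfl, h, rfl⟩⟩

theorem reach_subst_of_mem (hx : Function.Injective x) {s t : CatTerm n V}
    (h : (s, t) ∈ symmetricCatalanEquations n x) (φ : V → CatTerm n V) :
    Reach x (s.subst φ) (t.subst φ) :=
  ⟨basicOperator s t,
    Submonoid.subset_closure ⟨s, t, [], Or.inl h, (translateAt_nil _).symm⟩,
    ((isLinearTheory_symmetricCatalanEquations hx).isLinearSeed (Or.inl h)).isSeed.mem φ⟩

/-! ### Operations on lists of terms and normal forms -/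

/-- The operation `⊗` applied to a list of terms, which is meant to have length `n`; missing
arguments are filled up with `d`. -/
def opList (d : CatTerm n V) (l : List (CatTerm n V)) : CatTerm n V := op fun k => l.getD k d

/-- The substitution that sends `x_k` to the `k`-th entry of a list. -/
noncomputable def listSubst (x : ℕ → V) (d : CatTerm n V) (l : List (CatTerm n V)) :
    V → CatTerm n V :=
  Function.extend x (fun k => l.getD k d) var

theorem listSubst_apply (hx : Function.Injective x) (d : CatTerm n V)
    (l : List (CatTerm n V)) (k : ℕ) : listSubst x d l (x k) = l.getD k d :=
  hx.extend_apply _ _ k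

variable {d : CatTerm n V}

theorem reach_opList_head (hn : 2 ≤ n) (hx : Function.Injective x) {a b : CatTerm n V}
    (h : Reach x a b) (l : List (CatTerm n V)) :
    Reach x (opList d (a :: l)) (opList d (b :: l)) := by
  have := Reach.op_update hn hx (ts := fun k : Fin n => (a :: l).getD k d)
    (i := ⟨0, by omega⟩) (w := b) h
  convert this using 1
  · rfl
  simp only [opList, op.injEq]
  funext ⟨k, hk⟩
  cases k with
  | zero => simp
  | succ k => simp [Function.update_of_ne]

theorem reach_opList_swap (hx : Function.Injective x) (l r : List (CatTerm n V))
    (a b : CatTerm n V) (h : (l ++ a :: b :: r).length = n) :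
    Reach x (opList d (l ++ a :: b :: r)) (opList d (l ++ b :: a :: r)) := by
  have hlen : l.length + 1 < n := by
    simp only [List.length_append, List.length_cons] at h
    omega
  have := reach_subst_of_mem hx (Or.inr ⟨l.length, hlen, rfl⟩)
    (listSubst x d (l ++ a :: b :: r))
  simp only [subst, listSubst_apply hx] at this
  convert this using 1
  · rfl
  simp only [opList, op.injEq]
  funext ⟨k, hk⟩
  simp only [Equiv.swap_apply_def]
  grind

/-- The exchange of the inner operation between the first two positions. -/
theorem reach_opList_move (hn : 2 ≤ n) (hx : Function.Injective x) (a b : CatTerm n V)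
    (l r : List (CatTerm n V)) (hl : l.length + 1 = n) (hr : r.length + 2 = n) :
    Reach x (opList d (a :: opList d (l ++ [b]) :: r))
      (opList d (opList d (a :: l) :: b :: r)) := by
  have := reach_subst_of_mem hx (Or.inl ⟨1, one_pos, by omega, rfl⟩)
    (listSubst x d (a :: (l ++ b :: r)))
  convert this using 1
  · simp only [opList, catalanTerm, subst, op.injEq]
    funext ⟨k, hk⟩
    rcases k with _ | _ | k
    · simp [subst, listSubst_apply hx]
    · simp only [zero_add, lt_self_iff_false, if_false, if_true, subst, listSubst_apply hx,
        List.getD_cons_succ, List.getD_cons_zero, op.injEq]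
      funext ⟨m, hm⟩
      grind
    · grind [subst, listSubst_apply hx]
  · simp only [opList, catalanTerm, subst, op.injEq]
    funext ⟨k, hk⟩
    rcases k with _ | k
    · simp only [lt_self_iff_false, if_false, if_true, subst, listSubst_apply hx,
        List.getD_cons_zero, op.injEq]
      funext ⟨m, hm⟩
      grind
    · grind [subst, listSubst_apply hx]

/-- A relation on lists that allows transpositions of adjacent entries allows permutations. -/
theorem List.Perm.rel_of_swap {α : Type*} {R : List α → List α → Prop} (hrefl : ∀ l, R l l)
    (htrans : ∀ l m r, R l m → R m r → R l r) {N : ℕ}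
    (hswap : ∀ l r a b, (l ++ a :: b :: r).length = N → R (l ++ a :: b :: r) (l ++ b :: a :: r))
    {l m : List α} (h : l.Perm m) (hl : l.length = N) : R l m := by
  suffices ∀ p : List α, (p ++ l).length = N → R (p ++ l) (p ++ m) from this [] hl
  clear hl
  induction h with
  | nil => exact fun p _ => hrefl _
  | cons a _ ih =>
    intro p hp
    have := ih (p ++ [a]) (by simpa using hp)
    simpa using this
  | swap a b l => exact fun p hp => hswap p l b a hp
  | trans h1 _ ih1 ih2 =>
    intro p hp
    refine htrans _ _ _ (ih1 p hp) (ih2 p ?_)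
    simpa [h1.length_eq] using hp

theorem reach_opList_perm (hx : Function.Injective x) {l m : List (CatTerm n V)}
    (h : l.Perm m) (hl : l.length = n) : Reach x (opList d l) (opList d m) :=
  h.rel_of_swap (R := fun l m => Reach x (opList d l) (opList d m)) (fun _ => Reach.refl _)
    (fun _ _ _ => Reach.trans) (reach_opList_swap hx) hl

/-- In a nested operation, an argument of the inner operation may be exchanged with one of the
outer operation. -/
theorem reach_opList_exchange (hn : 2 ≤ n) (hx : Function.Injective x) (a b : CatTerm n V)
    (l r : List (CatTerm n V)) (hl : l.length + 1 = n) (hr : r.length + 2 = n) :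
    Reach x (opList d (opList d (l ++ [a]) :: b :: r))
      (opList d (opList d (l ++ [b]) :: a :: r)) := by
  have h1 : Reach x (opList d (l ++ [a])) (opList d (a :: l)) :=
    reach_opList_perm hx (List.perm_append_singleton a l) (by simpa using hl)
  refine (reach_opList_head hn hx h1 _).trans
    (((reach_opList_move hn hx a b l r hl hr).symm hx).trans ?_)
  exact reach_opList_swap hx [] r _ _ (by simpa using hr)

/-- The left comb with `k` operations whose leaves are the `1 + k (n - 1)` terms of a list: the
first `n` terms are combined by `⊗`, and the result takes their place. -/
def comb (d : CatTerm n V) : ℕ → List (CatTerm n V) → CatTerm n V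
  | 0, l => l.headD d
  | k + 1, l => comb d k (opList d (l.take n) :: l.drop n)

theorem reach_comb_head (hn : 2 ≤ n) (hx : Function.Injective x) {a b : CatTerm n V}
    (h : Reach x a b) (k : ℕ) (l : List (CatTerm n V)) :
    Reach x (comb d k (a :: l)) (comb d k (b :: l)) := by
  induction k generalizing a b l with
  | zero => exact h
  | succ k ih =>
    obtain ⟨m, rfl⟩ : ∃ m, n = m + 1 := ⟨n - 1, by omega⟩
    exact ih (reach_opList_head hn hx h _) _

theorem reach_comb_swap (hn : 2 ≤ n) (hx : Function.Injective x) (k : ℕ)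
    (l r : List (CatTerm n V)) (a b : CatTerm n V)
    (h : (l ++ a :: b :: r).length = 1 + k * (n - 1)) :
    Reach x (comb d k (l ++ a :: b :: r)) (comb d k (l ++ b :: a :: r)) := by
  induction k generalizing l with
  | zero => simp at h; omega
  | succ k ih =>
    have hmul : (k + 1) * (n - 1) = k * (n - 1) + (n - 1) := by ring
    simp only [List.length_append, List.length_cons, hmul] at h
    rcases lt_trichotomy (l.length + 1) n with hlt | heq | hgt
    · -- Both terms belong to the first block.
      obtain ⟨p, hp⟩ : ∃ p, n = l.length + 2 + p := ⟨n - (l.length + 2), by omega⟩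
      have key : ∀ c e : CatTerm n V, comb d (k + 1) (l ++ c :: e :: r) =
          comb d k (opList d (l ++ c :: e :: r.take p) :: r.drop p) := by
        intro c e
        have h1 : (l ++ c :: e :: r).take n = l ++ c :: e :: r.take p := by
          rw [List.take_append, List.take_of_length_le (by omega),
            show n - l.length = p + 2 by omega]
          rfl
        have h2 : (l ++ c :: e :: r).drop n = r.drop p := by
          rw [List.drop_append, List.drop_of_length_le (by omega),
            show n - l.length = p + 2 by omega]
          rfl
        rw [comb, h1, h2]
      rw [key, key]
      refine reach_comb_head hn hx (reach_opList_swap hx _ _ _ _ ?_) _ _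
      simp only [List.length_append, List.length_cons, List.length_take]
      omega
    · -- The first block ends between the two terms.
      have key : ∀ c e : CatTerm n V, comb d (k + 1) (l ++ c :: e :: r) =
          comb d k (opList d (l ++ [c]) :: e :: r) := by
        intro c e
        have h1 : (l ++ c :: e :: r).take n = l ++ [c] := by
          rw [List.take_append, List.take_of_length_le (by omega),
            show n - l.length = 1 by omega]
          rfl
        have h2 : (l ++ c :: e :: r).drop n = e :: r := by
          rw [List.drop_append, List.drop_of_length_le (by omega),
            show n - l.length = 1 by omega]
          rfl
        rw [comb, h1, h2]
      rw [key, key]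
      obtain _ | k := k
      · omega
      have hmul' : (k + 1) * (n - 1) = k * (n - 1) + (n - 1) := by ring
      obtain ⟨p, hp⟩ : ∃ p, n = p + 2 := ⟨n - 2, by omega⟩
      have key' : ∀ c e : CatTerm n V, comb d (k + 1) (c :: e :: r) =
          comb d k (opList d (c :: e :: r.take p) :: r.drop p) := by
        intro c e
        have h1 : (c :: e :: r).take n = c :: e :: r.take p :=
          congrArg (List.take · (c :: e :: r)) hp
        have h2 : (c :: e :: r).drop n = r.drop p := congrArg (List.drop · (c :: e :: r)) hp
        rw [comb, h1, h2]
      rw [key', key']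
      refine reach_comb_head hn hx
        (reach_opList_exchange hn hx a b l _ heq ?_) _ _
      rw [List.length_take]
      omega
    · -- Both terms come after the first block.
      have key : ∀ q : List (CatTerm n V), comb d (k + 1) (l ++ q) =
          comb d k ((opList d (l.take n) :: l.drop n) ++ q) := by
        intro q
        rw [comb, List.take_append_of_le_length (by omega),
          List.drop_append_of_le_length (by omega)]
        rfl
      rw [key, key]
      refine ih _ ?_
      simp only [List.length_append, List.length_cons, List.length_drop]
      omega

theorem reach_comb_perm (hn : 2 ≤ n) (hx : Function.Injective x) {k : ℕ}
    {l m : List (CatTerm n V)} (h : l.Perm m) (hl : l.length = 1 + k * (n - 1)) :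
    Reach x (comb d k l) (comb d k m) :=
  h.rel_of_swap (R := fun l m => Reach x (comb d k l) (comb d k m)) (fun _ => Reach.refl _)
    (fun _ _ _ => Reach.trans) (reach_comb_swap hn hx k) hl

theorem comb_add_append (hn : 2 ≤ n) (k K : ℕ) (l r : List (CatTerm n V))
    (h : l.length = 1 + k * (n - 1)) :
    comb d (k + K) (l ++ r) = comb d K (comb d k l :: r) := by
  induction k generalizing l with
  | zero =>
    obtain ⟨a, rfl⟩ := List.length_eq_one_iff.1 (by simpa using h)
    simp [comb]
  | succ k ih =>
    have hmul : (k + 1) * (n - 1) = k * (n - 1) + (n - 1) := by ring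
    rw [show k + 1 + K = k + K + 1 by ring, comb, comb, List.take_append_of_le_length (by omega),
      List.drop_append_of_le_length (by omega), ← List.cons_append]
    refine ih _ ?_
    simp only [List.length_cons, List.length_drop]
    omega

/-- A leaf of a comb that is itself a comb may be dissolved into its leaves. -/
theorem reach_comb_dissolve (hn : 2 ≤ n) (hx : Function.Injective x) {k K : ℕ} {t : CatTerm n V}
    {m : List (CatTerm n V)} (ht : Reach x t (comb d k m)) (hm : m.length = 1 + k * (n - 1))
    (l r : List (CatTerm n V)) (h : (l ++ t :: r).length = 1 + K * (n - 1)) :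
    Reach x (comb d K (l ++ t :: r)) (comb d (k + K) (l ++ (m ++ r))) := by
  refine (reach_comb_perm hn hx List.perm_middle h).trans
    ((reach_comb_head hn hx ht _ _).trans ?_)
  rw [← comb_add_append hn k K m _ hm]
  refine reach_comb_perm hn hx ?_ ?_
  · rw [← List.append_assoc, ← List.append_assoc]
    exact List.perm_append_comm.append_right r
  · simp only [List.length_append, List.length_cons, add_mul] at h ⊢
    omega

theorem exists_reach_comb_flatMap (hn : 2 ≤ n) (hx : Function.Injective x)
    (f : CatTerm n V → List (CatTerm n V)) (r : List (CatTerm n V))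
    (hr : ∀ t ∈ r, ∃ k, (f t).length = 1 + k * (n - 1) ∧ Reach x t (comb d k (f t)))
    (l : List (CatTerm n V)) {K : ℕ} (h : (l ++ r).length = 1 + K * (n - 1)) :
    ∃ k, (l ++ r.flatMap f).length = 1 + k * (n - 1) ∧
      Reach x (comb d K (l ++ r)) (comb d k (l ++ r.flatMap f)) := by
  induction r generalizing l K with
  | nil => exact ⟨K, h, Reach.refl _⟩
  | cons t r ih =>
    obtain ⟨k, hk, ht⟩ := hr t (by simp)
    have hd := reach_comb_dissolve hn hx ht hk l r h
    obtain ⟨k', hk', h'⟩ := ih (fun s hs => hr s (by simp [hs])) (l ++ f t) (K := k + K) (by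
      simp only [List.length_append, List.length_cons, add_mul] at h ⊢
      omega)
    rw [← List.append_assoc] at hd
    refine ⟨k', ?_, ?_⟩
    · simpa [add_assoc] using hk'
    · rw [List.flatMap_cons, ← List.append_assoc]
      exact hd.trans h'

/-- Each term is connected to the comb of its variables. -/
theorem exists_reach_comb_var (hn : 2 ≤ n) (hx : Function.Injective x) (d t : CatTerm n V) :
    ∃ k, (t.underlyingList.map var : List (CatTerm n V)).length = 1 + k * (n - 1) ∧
      Reach x t (comb d k (t.underlyingList.map var)) := by
  induction t with
  | var y => exact ⟨0, by simp [underlyingList], Reach.refl _⟩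
  | op ts ih =>
    have h := exists_reach_comb_flatMap hn hx (d := d) (fun t => t.underlyingList.map var)
      (List.ofFn ts) (fun t ht => by
        obtain ⟨i, rfl⟩ := List.mem_ofFn.1 ht
        exact ih i) [] (K := 1) (by simp; omega)
    have h1 : comb d 1 (List.ofFn ts) = op ts := by
      have : (List.ofFn ts).take n = List.ofFn ts := List.take_of_length_le (by simp)
      rw [comb, comb, List.headD_cons, this, opList]
      congr 1
      funext k
      simp
    have h2 : (List.ofFn ts).flatMap (fun t => (t.underlyingList.map var : List (CatTerm n V))) =
        (op ts).underlyingList.map var := by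
      rw [underlyingList, List.flatMap_def, List.map_flatten, List.map_ofFn, List.map_ofFn]
      rfl
    simpa only [List.nil_append, h1, h2] using h

/-- Coherence of the theory of symmetric catalan algebras: two terms with the same variables, counted
with multiplicity, are connected by the structure monoid. -/
theorem reach_of_perm (hn : 2 ≤ n) (hx : Function.Injective x) {s t : CatTerm n V}
    (h : s.underlyingList.Perm t.underlyingList) : Reach x s t := by
  obtain ⟨k, hk, hs⟩ := exists_reach_comb_var hn hx s s
  obtain ⟨k', hk', ht⟩ := exists_reach_comb_var hn hx s t
  have hkk : k = k' := by
    have := h.length_eq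
    simp only [List.length_map] at hk hk'
    exact Nat.eq_of_mul_eq_mul_right (show 0 < n - 1 by omega) (by omega)
  subst hkk
  exact hs.trans ((reach_comb_perm hn hx (h.map _) hk).trans (ht.symm hx))

end Coherence

/-! ### The universal group of a monoid -/

section UniversalGroup

variable {M : Type*} [Monoid M]

theorem toUniversalGroup_mul (a b : M) :
    toUniversalGroup (a * b) = toUniversalGroup a * toUniversalGroup b :=
  (mul_inv_eq_one.1 (PresentedGroup.one_of_mem (rels := {r : FreeGroup M |
    ∃ a b : M, r = FreeGroup.of a * FreeGroup.of b * (FreeGroup.of (a * b))⁻¹}) ⟨a, b, rfl⟩)).symm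

theorem toUniversalGroup_eq_one_of_mul_self {e : M} (h : e * e = e) : toUniversalGroup e = 1 := by
  have := toUniversalGroup_mul e e
  rwa [h, left_eq_mul] at this

/-- If each element of a monoid has a partner with idempotent product then its universal group
consists of the classes of the elements of the monoid. -/
theorem toUniversalGroup_surjective
    (h : ∀ a : M, ∃ b, (a * b) * (a * b) = a * b) :
    Function.Surjective (toUniversalGroup : M → UniversalGroup M) := by
  intro g
  have hg : g ∈ Subgroup.closure (Set.range (toUniversalGroup : M → UniversalGroup M)) := by
    have : Subgroup.closure (Set.range (toUniversalGroup : M → UniversalGroup M)) = ⊤ :=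
      PresentedGroup.closure_range_of _
    simp [this]
  induction hg using Subgroup.closure_induction with
  | mem g hg => exact hg
  | one => exact ⟨1, toUniversalGroup_eq_one_of_mul_self (one_mul 1)⟩
  | mul g k _ _ hg hk =>
    obtain ⟨a, rfl⟩ := hg
    obtain ⟨b, rfl⟩ := hk
    exact ⟨a * b, toUniversalGroup_mul a b⟩
  | inv g _ hg =>
    obtain ⟨a, rfl⟩ := hg
    obtain ⟨b, hb⟩ := h a
    refine ⟨b, eq_inv_of_mul_eq_one_right ?_⟩
    rw [← toUniversalGroup_mul, toUniversalGroup_eq_one_of_mul_self hb]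

theorem exists_universalGroup_lift {G : Type*} [Group G] (f : M →* G) :
    ∃ F : UniversalGroup M →* G, ∀ a, F (toUniversalGroup a) = f a := by
  refine ⟨PresentedGroup.toGroup (f := f) ?_, fun a => PresentedGroup.toGroup.of _⟩
  rintro r ⟨a, b, rfl⟩
  simp

end UniversalGroup

/-! ### The homomorphism to the Higman–Thompson group -/

section Isomorphism

open CatTerm

variable {n : ℕ} {V : Type*} {x : ℕ → V}

/-- The tree symbols of the linear pairs in the graph of `ρ` coincide, since all these pairs are
instances of one linear seed. They define a homomorphism. -/
theorem IsLinearTheory.exists_symbolHom {E : Set (CatTerm n V × CatTerm n V)}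
    (hE : IsLinearTheory E) (hx : Function.Injective x) :
    ∃ θ : structureMonoid E →* HigmanThompson n, ∀ (ρ : structureMonoid E) (s t : CatTerm n V),
      s.Linear → t ∈ (ρ : PartialEndo (CatTerm n V)) s → IsSymbolOf (θ ρ) s t := by
  choose p q hpq using fun ρ : structureMonoid E => hE.exists_isLinearSeed hx ρ.2
  choose g hg using fun ρ => (hpq ρ).left.exists_isSymbolOf (hpq ρ).right (hpq ρ).support_eq
  have key : ∀ (ρ : structureMonoid E) (s t : CatTerm n V), s.Linear →
      t ∈ (ρ : PartialEndo (CatTerm n V)) s → IsSymbolOf (g ρ) s t := by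
    intro ρ s t hs hst
    have hp := (hpq ρ).perm_of_mem hst
    obtain ⟨φ, rfl, rfl⟩ := ((hpq ρ).isSeed _ _).1 hst
    exact (hg ρ).subst hs (hs.of_perm hp) (support_eq_of_perm hp)
  refine ⟨MonoidHom.mk' g ?_, key⟩
  intro ρ σ
  have h := hpq (ρ * σ)
  obtain ⟨w, hw, hw'⟩ := PartialEndo.mem_mul.1 h.isSeed.mem_self
  have hwl := h.left.of_perm ((hpq ρ).perm_of_mem hw)
  exact (hg (ρ * σ)).unique h.right ((key ρ _ _ h.left hw).mul (key σ _ _ hwl hw'))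

/-- The product of an element of the structure monoid with its inverse is idempotent. -/
theorem IsLinearTheory.exists_mul_idempotent {E : Set (CatTerm n V × CatTerm n V)}
    (hE : IsLinearTheory E) (ρ : structureMonoid E) :
    ∃ σ : structureMonoid E, (ρ * σ) * (ρ * σ) = ρ * σ := by
  obtain ⟨ρ', hρ', h⟩ := hE.exists_inverse ρ.2
  refine ⟨⟨ρ', hρ'⟩, Subtype.ext (PartialEndo.ext fun u v => ?_)⟩
  have hid : ∀ u v : CatTerm n V, v ∈ ((ρ : PartialEndo (CatTerm n V)) * ρ') u → v = u := by
    intro u v huv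
    obtain ⟨w, hw, hv⟩ := PartialEndo.mem_mul.1 huv
    exact Part.mem_unique hv ((h _ _).1 hw)
  change v ∈ ((ρ : PartialEndo (CatTerm n V)) * ρ' * (ρ * ρ')) u ↔
    v ∈ ((ρ : PartialEndo (CatTerm n V)) * ρ') u
  rw [PartialEndo.mem_mul]
  constructor
  · rintro ⟨w, hw, hv⟩
    rwa [hid _ _ hw] at hv
  · intro hv
    obtain rfl := hid _ _ hv
    exact ⟨v, hv, hv⟩

/-- The structure monoid contains partial identities with arbitrarily small domain: each term in the
domain has an operation at each inner vertex of a given tree. -/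
theorem exists_partial_identity (hn : 2 ≤ n) (hx : Function.Injective x) (R : NTree n) :
    ∃ ε ∈ structureMonoid (symmetricCatalanEquations n x),
      ∀ u v : CatTerm n V, v ∈ ε u → v = u ∧ R.Le u.tree := by
  induction R with
  | leaf => exact ⟨1, one_mem _, fun u v h => ⟨PartialEndo.mem_one.1 h, trivial⟩⟩
  | node Rs ih =>
    choose δ hδ hδ' using ih
    suffices ∀ I : Finset (Fin n), ∃ ε ∈ structureMonoid (symmetricCatalanEquations n x),
        ∀ u v : CatTerm n V, v ∈ ε u → v = u ∧ ∃ ts, u = op ts ∧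
          ∀ i ∈ I, (Rs i).Le (ts i).tree by
      obtain ⟨ε, hε, h⟩ := this Finset.univ
      refine ⟨ε, hε, fun u v huv => ?_⟩
      obtain ⟨rfl, ts, rfl, hts⟩ := h u v huv
      exact ⟨rfl, fun i => hts i (Finset.mem_univ i)⟩
    intro I
    induction I using Finset.induction_on with
    | empty =>
      obtain ⟨ε, hε, h⟩ := exists_partial_identity_op hn hx
      refine ⟨ε, hε, fun u v huv => ?_⟩
      obtain ⟨rfl, ts, rfl⟩ := (h u v).1 huv
      exact ⟨rfl, ts, rfl, by simp⟩
    | insert i I _ ihI =>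
      obtain ⟨ε, hε, h⟩ := ihI
      refine ⟨ε * translateAt (δ i) [i],
        mul_mem hε (translateAt_singleton_mem hn hx (hδ i) i), fun u v huv => ?_⟩
      obtain ⟨w, hw, hv⟩ := PartialEndo.mem_mul.1 huv
      obtain ⟨rfl, ts, rfl, hts⟩ := h _ _ hw
      obtain ⟨us, z, hus, hz, rfl⟩ := mem_translateAt_singleton.1 hv
      obtain rfl := op.inj hus
      obtain ⟨rfl, hle⟩ := hδ' i _ _ hz
      refine ⟨by rw [Function.update_eq_self], ts, rfl, fun j hj => ?_⟩
      rcases Finset.mem_insert.1 hj with rfl | hj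
      · exact hle
      · exact hts j hj

/-- An element of the structure monoid with trivial tree symbol has trivial class in the structure
group: it is the identity on all terms that extend some tree, so it is absorbed by a partial identity
with small domain. -/
theorem toUniversalGroup_eq_one_of_isSymbolOf_one (hn : 2 ≤ n) (hx : Function.Injective x)
    {ρ : structureMonoid (symmetricCatalanEquations n x)} {s t : CatTerm n V}
    (h : IsLinearSeed (ρ : PartialEndo (CatTerm n V)) s t) (h1 : IsSymbolOf 1 s t) :
    toUniversalGroup ρ = 1 := by
  obtain ⟨φ, hl, hφ⟩ := h1.exists_subst_eq hx h.left h.perm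
  obtain ⟨ε, hε, hid⟩ := exists_partial_identity hn hx (s.subst φ).tree
  suffices (⟨ε, hε⟩ : structureMonoid (symmetricCatalanEquations n x)) * ρ = ⟨ε, hε⟩ by
    have h2 := toUniversalGroup_mul
      (⟨ε, hε⟩ : structureMonoid (symmetricCatalanEquations n x)) ρ
    rwa [this, left_eq_mul] at h2
  refine Subtype.ext (PartialEndo.ext fun u v => ?_)
  change v ∈ (ε * (ρ : PartialEndo (CatTerm n V))) u ↔ v ∈ ε u
  -- The elements of the domain of `ε` are instances of `s^φ = t^φ`, hence fixed by `ρ`.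
  have fix : ∀ w, w ∈ ε u → w ∈ (ρ : PartialEndo (CatTerm n V)) w := by
    intro w hw
    obtain ⟨rfl, hle⟩ := hid _ _ hw
    obtain ⟨θ, hθ⟩ := hl.exists_subst_eq hle
    have := h.isSeed.mem fun y => (φ y).subst θ
    rwa [← subst_subst, ← subst_subst, ← hφ, hθ] at this
  rw [PartialEndo.mem_mul]
  constructor
  · rintro ⟨w, hw, hv⟩
    rwa [Part.mem_unique hv (fix w hw)]
  · exact fun hv => ⟨v, hv, fix v hv⟩

/-- Each tree symbol is the tree symbol of a pair of linear terms with the same variables. -/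
theorem exists_isSymbolOf_eq (hx : Function.Injective x) (g : HigmanThompson n) :
    ∃ s t : CatTerm n V, s.Linear ∧ t.Linear ∧ s.support = t.support ∧ IsSymbolOf g s t := by
  classical
  obtain ⟨S, T, σ, rfl⟩ := HigmanThompson.exists_symbol g
  set a : List (Fin n) → V := fun w => x (Encodable.encode w) with ha
  have ha' : Function.Injective a := hx.comp Encodable.encode_injective
  set b : List (Fin n) → V := fun w => if h : w ∈ T.leaves then a (σ.symm ⟨w, h⟩) else x 0 with hb
  have hbσ : ∀ l : S.leaves, b (σ l) = a l := fun l => by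
    simp only [hb]
    rw [dif_pos (σ l).2, Subtype.coe_eta, Equiv.symm_apply_apply]
  have hs : (ofTree S a : CatTerm n V).Linear := linear_ofTree ha'.injOn
  have ht : (ofTree T b : CatTerm n V).Linear := by
    refine linear_ofTree fun v hv w hw hvw => ?_
    simp only [hb] at hvw
    rw [dif_pos hv, dif_pos hw] at hvw
    exact congrArg Subtype.val (σ.symm.injective (Subtype.ext (ha' hvw)))
  have hsupp : (ofTree S a : CatTerm n V).support = (ofTree T b).support := by
    ext y
    rw [mem_support_ofTree, mem_support_ofTree]
    constructor
    · rintro ⟨l, hl, rfl⟩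
      exact ⟨σ ⟨l, hl⟩, (σ ⟨l, hl⟩).2, hbσ ⟨l, hl⟩⟩
    · rintro ⟨m, hm, rfl⟩
      refine ⟨σ.symm ⟨m, hm⟩, (σ.symm ⟨m, hm⟩).2, ?_⟩
      rw [← hbσ, Equiv.apply_symm_apply]
  refine ⟨ofTree S a, ofTree T b, hs, ht, hsupp, ?_⟩
  -- The trees of the two terms equal `S` and `T` only propositionally, so `σ` is transported.
  have main : ∀ (S' T' : NTree n) (hS : S = S') (hT : T = T'),
      ∃ σ' : S'.leaves ≃ T'.leaves,
        (∀ l, (ofTree T b : CatTerm n V).sub (σ' l) = (ofTree S a).sub l) ∧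
        HigmanThompson.symbol S T σ = HigmanThompson.symbol S' T' σ' := by
    rintro _ _ rfl rfl
    refine ⟨σ, fun l => ?_, rfl⟩
    rw [sub_ofTree b (σ l).2, sub_ofTree a l.2, hbσ]
  exact main _ _ (tree_ofTree S a).symm (tree_ofTree T b).symm

end Isomorphism

theorem mainTheorem6 (n : ℕ) (hn : 2 ≤ n) {V : Type*} (x : ℕ → V) (hx : Function.Injective x) :
    ∃ Θ : StructureGroup (symmetricCatalanEquations n x) ≃* HigmanThompson n,
      ∀ ρ : structureMonoid (symmetricCatalanEquations n x),
        (∃ s t : CatTerm n V, IsSeed (ρ : PartialEndo (CatTerm n V)) s t) ∧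
        ∀ s t : CatTerm n V, IsSeed (ρ : PartialEndo (CatTerm n V)) s t →
          s.Linear ∧ t.Linear ∧ s.support = t.support ∧
          ∃ σ : s.tree.leaves ≃ t.tree.leaves,
            (∀ l : s.tree.leaves, t.sub (σ l) = s.sub l) ∧
            Θ (toUniversalGroup ρ) = HigmanThompson.symbol s.tree t.tree σ := by
  have hE : IsLinearTheory (symmetricCatalanEquations n x) :=
    isLinearTheory_symmetricCatalanEquations hx
  obtain ⟨θ, hθ⟩ := hE.exists_symbolHom hx
  obtain ⟨F, hF⟩ := exists_universalGroup_lift θ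
  have inj : Function.Injective F := by
    rw [injective_iff_map_eq_one]
    intro g hg
    obtain ⟨ρ, rfl⟩ := toUniversalGroup_surjective hE.exists_mul_idempotent g
    obtain ⟨s, t, h⟩ := hE.exists_isLinearSeed hx ρ.2
    rw [hF] at hg
    exact toUniversalGroup_eq_one_of_isSymbolOf_one hn hx h
      (hg ▸ hθ ρ s t h.left h.isSeed.mem_self)
  have surj : Function.Surjective F := by
    intro g
    obtain ⟨s, t, hs, ht, hst, hg⟩ := exists_isSymbolOf_eq hx g
    obtain ⟨ρ, hρ, h⟩ := reach_of_perm hn hx (hs.perm ht hst)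
    exact ⟨toUniversalGroup ⟨ρ, hρ⟩, (hF _).trans ((hθ ⟨ρ, hρ⟩ s t hs h).unique ht hg)⟩
  refine ⟨MulEquiv.ofBijective F ⟨inj, surj⟩, fun ρ => ?_⟩
  obtain ⟨s, t, h⟩ := hE.exists_isLinearSeed hx ρ.2
  refine ⟨⟨s, t, h.isSeed⟩, fun s' t' hseed => ?_⟩
  have h' := h.of_isSeed (by omega) hseed
  obtain ⟨σ, hσ, hsym⟩ := hθ ρ s' t' h'.left hseed.mem_self
  exact ⟨h'.left, h'.right, h'.support_eq, σ, hσ, (hF ρ).trans hsym⟩
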